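/- All digraphs are finite and have neither loops nor parallel arcs. The lexicographic product $G\circ H$ of digraphs $G$ and $H$ is the digraph with vertex set $V(G)\times V(H)$ in which there is an arc from $(u,u')$ to $(v,v')$ if and only if $uv\in A(G)$, or $u=v$ and $u'v'\in A(H)$. A digraph is strong if for any two vertices $x,y$ it contains a directed path from $x$ to $y$ and one from $y$ to $x$; it is symmetric if with each arc $xy$ it contains the arc $yx$; it is semicomplete if any two distinct vertices are joined by at least one arc. For a set $S$ of vertices of a digraph $D$, an $S$-strong subgraph of $D$ is a strong subgraph of $D$ whose vertex set contains $S$; subgraphs are arc-disjoint if no two of them have a common arc. Let $\overline{K}_2$ be the digraph with two vertices and no arcs. Let $G$ and $H$ be digraphs with $|V(G)|\ge 2$ such that one of the following conditions holds: (i) $G$ is strong and symmetric; (ii) $G$ is strong and semicomplete, and $H\not\cong\overline{K}_2$. Then for every $S\subseteq V(G\circ H)$ with $2\le |S|\le |V(G\circ H)|$, the digraph $G\circ H$ has at least $|V(H)|$ pairwise arc-disjoint $S$-strong subgraphs. Moreover, such subgraphs can be found in polynomial time: there are an algorithm (a program for a random access machine with addition and subtraction, each instruction having constant cost) and a polynomial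 $p$ such that for all $G$, $H$ and $S$ as above, the algorithm, given the adjacency matrices of $G$ and $H$ and the indicator function of $S$, halts after at most $p(|V(G\circ H)|)$ steps and outputs the vertex sets and arc sets of $|V(H)|$ pairwise arc-disjoint $S$-strong subgraphs of $G\circ H$. -/

import Mathlib

universe u v

namespace StrongPacking

/-! ### Digraphs

A digraph on `V` is a `Digraph V`; the digraphs of the theorem have finitely many vertices and no
loops (parallel arcs cannot occur). -/

/-- No arc joins a vertex to itself. -/
def Loopless {V : Type*} (D : Digraph V) : Prop :=
  ∀ v, ¬ D.Adj v v

/-- From every vertex there is a directed path to every other vertex. -/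
def IsStrong {V : Type*} (D : Digraph V) : Prop :=
  ∀ x y, Relation.ReflTransGen D.Adj x y

/-- With every arc the digraph contains the reverse arc. -/
def IsSymmetric {V : Type*} (D : Digraph V) : Prop :=
  ∀ x y, D.Adj x y → D.Adj y x

/-- Any two distinct vertices are joined by at least one arc. -/
def IsSemicomplete {V : Type*} (D : Digraph V) : Prop :=
  ∀ x y, x ≠ y → D.Adj x y ∨ D.Adj y x

/-- Isomorphism of digraphs. -/
def IsIsomorphic {V W : Type*} (D : Digraph V) (E : Digraph W) : Prop :=
  Nonempty (D.Adj ≃r E.Adj)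

/-- The lexicographic product `G ∘ H`. -/
def lexProduct {V W : Type*} (G : Digraph V) (H : Digraph W) : Digraph (V × W) where
  Adj p q := G.Adj p.1 q.1 ∨ (p.1 = q.1 ∧ H.Adj p.2 q.2)

/-- A subgraph of a digraph: a set of vertices and a set of arcs of `D` between these vertices. -/
@[ext]
structure Subdigraph {V : Type*} (D : Digraph V) where
  verts : Set V
  Adj : V → V → Prop
  adj_sub : ∀ {x y}, Adj x y → D.Adj x y
  fst_mem : ∀ {x y}, Adj x y → x ∈ verts
  snd_mem : ∀ {x y}, Adj x y → y ∈ verts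

/-- The subgraph is strong: any of its vertices is reachable from any other one inside it. -/
def Subdigraph.IsStrong {V : Type*} {D : Digraph V} (F : Subdigraph D) : Prop :=
  ∀ x ∈ F.verts, ∀ y ∈ F.verts, Relation.ReflTransGen F.Adj x y

/-- An `S`-strong subgraph is a strong subgraph whose vertex set contains `S`. -/
def Subdigraph.IsSStrong {V : Type*} {D : Digraph V} (F : Subdigraph D) (S : Finset V) : Prop :=
  F.IsStrong ∧ (S : Set V) ⊆ F.verts

/-- Two subgraphs are arc-disjoint if they have no common arc. -/
def Subdigraph.ArcDisjoint {V : Type*} {D : Digraph V} (F F' : Subdigraph D) : Prop :=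
  ∀ x y, ¬ (F.Adj x y ∧ F'.Adj x y)

/-- The family `F` consists of pairwise arc-disjoint `S`-strong subgraphs of `D`. -/
def IsSStrongPacking {V ι : Type*} {D : Digraph V} (S : Finset V) (F : ι → Subdigraph D) : Prop :=
  (∀ k, (F k).IsSStrong S) ∧ ∀ k l, k ≠ l → (F k).ArcDisjoint (F l)

/-- The hypothesis on the factors: finite loopless digraphs such that `G` has at least two
vertices and is strong symmetric, or strong semicomplete with `H` not the arcless digraph on two
vertices. -/
structure Admissible {V W : Type*} [Fintype V] (G : Digraph V) (H : Digraph W) : Prop where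
  loopless_left : Loopless G
  loopless_right : Loopless H
  two_le_card : 2 ≤ Fintype.card V
  cond : (IsStrong G ∧ IsSymmetric G) ∨
    (IsStrong G ∧ IsSemicomplete G ∧ ¬ IsIsomorphic H (Digraph.emptyDigraph (Fin 2)))

/-! ### The machine model

Algorithms are programs for a random access machine with natural number registers and arrays,
written with structured control flow.  The arithmetic instructions are addition and (truncated)
subtraction only (in particular no multiplication), so that values have at most linearly many bits
in the number of steps plus the size of the input, and counting every instruction and every test
with constant cost gives the usual notion of polynomial time. -/

/-- The memory: numbered scalar variables, and numbered arrays, whose cells are addressed by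
finite tuples of natural numbers. -/
structure Store where
  var : ℕ → ℕ
  arr : ℕ → List ℕ → ℕ

/-- Write `v` into the scalar variable `x`. -/
def Store.setVar (s : Store) (x v : ℕ) : Store where
  var := Function.update s.var x v
  arr := s.arr

/-- Write `v` into the cell `i` of the array `a`. -/
def Store.setArr (s : Store) (a : ℕ) (i : List ℕ) (v : ℕ) : Store where
  var := s.var
  arr := Function.update s.arr a (Function.update (s.arr a) i v)

/-- Tests: comparison of two scalar variables. -/
inductive Test where
  | lt (x y : ℕ)
  | eq (x y : ℕ)

/-- The test succeeds in the store `s`. -/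
def Test.Holds (s : Store) : Test → Prop
  | .lt x y => s.var x < s.var y
  | .eq x y => s.var x = s.var y

/-- Programs.  The arguments `x y z` are names of scalar variables, `a` is the name of an array,
`idx` is a list of names of scalar variables, `n` is a literal. -/
inductive Prog where
  /-- do nothing -/
  | skip
  /-- `x := n` -/
  | const (x n : ℕ)
  /-- `x := y` -/
  | copy (x y : ℕ)
  /-- `x := y + z` -/
  | add (x y z : ℕ)
  /-- `x := y - z`, truncated at zero -/
  | sub (x y z : ℕ)
  /-- `x := a[idx]` -/
  | load (x a : ℕ) (idx : List ℕ)
  /-- `a[idx] := x` -/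
  | store (a : ℕ) (idx : List ℕ) (x : ℕ)
  /-- `P; Q` -/
  | seq (P Q : Prog)
  /-- `if b then P else Q` -/
  | ite (b : Test) (P Q : Prog)
  /-- `while b do P` -/
  | while (b : Test) (P : Prog)

/-- `Exec P s s' t`: started in the store `s`, the program `P` halts in the store `s'` after
exactly `t` steps.  An array access with `k` indices takes `k + 1` steps; any other instruction,
and any evaluation of a test, takes one step. -/
inductive Exec : Prog → Store → Store → ℕ → Prop where
  | skip (s : Store) : Exec .skip s s 1
  | const (s : Store) (x n : ℕ) : Exec (.const x n) s (s.setVar x n) 1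
  | copy (s : Store) (x y : ℕ) : Exec (.copy x y) s (s.setVar x (s.var y)) 1
  | add (s : Store) (x y z : ℕ) :
      Exec (.add x y z) s (s.setVar x (s.var y + s.var z)) 1
  | sub (s : Store) (x y z : ℕ) :
      Exec (.sub x y z) s (s.setVar x (s.var y - s.var z)) 1
  | load (s : Store) (x a : ℕ) (idx : List ℕ) :
      Exec (.load x a idx) s (s.setVar x (s.arr a (idx.map s.var))) (idx.length + 1)
  | store (s : Store) (a : ℕ) (idx : List ℕ) (x : ℕ) :
      Exec (.store a idx x) s (s.setArr a (idx.map s.var) (s.var x)) (idx.length + 1)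
  | seq {P Q : Prog} {s s' s'' : Store} {t t' : ℕ} :
      Exec P s s' t → Exec Q s' s'' t' → Exec (.seq P Q) s s'' (t + t')
  | iteTrue {b : Test} {P Q : Prog} {s s' : Store} {t : ℕ} :
      b.Holds s → Exec P s s' t → Exec (.ite b P Q) s s' (t + 1)
  | iteFalse {b : Test} {P Q : Prog} {s s' : Store} {t : ℕ} :
      ¬ b.Holds s → Exec Q s s' t → Exec (.ite b P Q) s s' (t + 1)
  | whileTrue {b : Test} {P : Prog} {s s' s'' : Store} {t t' : ℕ} :
      b.Holds s → Exec P s s' t → Exec (.while b P) s' s'' t' →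
        Exec (.while b P) s s'' (t + t' + 1)
  | whileFalse {b : Test} {P : Prog} {s : Store} :
      ¬ b.Holds s → Exec (.while b P) s s 1

/-! ### Input and output -/

open Classical in
/-- The initial store for digraphs `G` on `{0, …, n - 1}`, `H` on `{0, …, m - 1}` and a set `S` of
vertices of the product: variables `0` and `1` hold `n` and `m`, arrays `0` and `1` hold the
adjacency matrices of `G` and `H`, and array `2` holds the indicator function of `S`.  Everything
else is zero. -/
noncomputable def inputStore {n m : ℕ} (G : Digraph (Fin n)) (H : Digraph (Fin m))
    (S : Finset (Fin n × Fin m)) : Store where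
  var x := if x = 0 then n else if x = 1 then m else 0
  arr a i :=
    if (a = 0 ∧ ∃ u v : Fin n, i = [u.val, v.val] ∧ G.Adj u v) ∨
       (a = 1 ∧ ∃ u v : Fin m, i = [u.val, v.val] ∧ H.Adj u v) ∨
       (a = 2 ∧ ∃ p ∈ S, i = [p.1.val, p.2.val])
    then 1 else 0

/-- The store `s` describes the family `F` of `m` subgraphs of the product: array `3` holds the
indicator functions of the vertex sets and array `4` those of the arc sets. -/
def Outputs {n m : ℕ} {D : Digraph (Fin n × Fin m)} (s : Store) (F : Fin m → Subdigraph D) : Prop :=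
  ∀ k : Fin m,
    (∀ p : Fin n × Fin m,
      s.arr 3 [k.val, p.1.val, p.2.val] = 1 ↔ p ∈ (F k).verts) ∧
    (∀ p q : Fin n × Fin m,
      s.arr 4 [k.val, p.1.val, p.2.val, q.1.val, q.2.val] = 1 ↔ (F k).Adj p q)

end StrongPacking

/-! Put m = |V(H)| and identify V(H) with the integers modulo m. All m subgraphs are spanning, so
one packing serves every S. For each arc ac of G, the m² arcs from the copy of H at a to the copy at
c split into m perfect matchings, one for each subgraph; matching k sends b to b + s, where the
shift s depends on k and sometimes on b. Disjointness means that, for a fixed arc and a fixed b,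
different k have shifts that differ modulo m. As G is strong and the matchings are perfect, a
subgraph is strong once the fibre over a single vertex u is strongly connected in it
(`packing_isStrong_of_fibre`).

To connect this fibre, take a directed 2-cycle or 3-cycle through u (`exists_isShortCycle`) and
choose the shifts along it so that one lap is a permutation of the fibre with a single orbit. On a
2-cycle the shifts k and 1 - k make the lap b ↦ b + 1. On a 3-cycle with m odd, k, k and 1 - 2k do
the same. If m is even, doubling is not injective; the shifts k, k - 1, 2 - 2k for 1 ≤ k ≤ m/2 and
k, k, 1 - 2k for larger k still add up to 1, and row 0 is left with the lap b ↦ b + m/2 + 1, which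
has a single orbit if 4 divides m.

If m is 2 modulo 4, translations cannot suffice: all shifts together add up to 3m(m - 1)/2, which is
odd, whereas m generators of the cyclic group are odd numbers with an even sum. So the first
matching is rearranged in the rows -2, -1, 0, 1 into permutations that are not translations and
whose laps are m-cycles (`linked_lap`). For m = 2 this is impossible; row 0 has the identity as lap,
and an arc of H inside the fibres replaces the missing connection.

The shifts are explicit, so a program needs only a search over triples for a short cycle and nested
loops filling the output. A Hoare logic with time bounds proves it correct, and the bound is visibly
a polynomial. -/

namespace StrongPacking

/-! ### Expressions and their compilation -/

/-- The part of the store that compiled programs work with: the registers from `20` on are used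
for the evaluation of expressions only. -/
structure Mem where
  env : Fin 20 → ℕ
  arr : ℕ → List ℕ → ℕ

def Store.mem (s : Store) : Mem where
  env x := s.var x
  arr := s.arr

def Mem.set (a : Mem) (x : Fin 20) (v : ℕ) : Mem where
  env := Function.update a.env x v
  arr := a.arr

def Mem.put (a : Mem) (b : ℕ) (i : List ℕ) (v : ℕ) : Mem where
  env := a.env
  arr := Function.update a.arr b (Function.update (a.arr b) i v)

@[ext]
theorem Mem.ext' {a b : Mem} (h : a.env = b.env) (h' : a.arr = b.arr) : a = b := by
  cases a; cases b; simp_all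

theorem Store.mem_setVar (s : Store) (x : Fin 20) (v : ℕ) :
    (s.setVar x v).mem = s.mem.set x v := by
  ext y
  · simp only [Store.mem, Store.setVar, Mem.set, Function.update_apply, Fin.val_inj]
  · rfl

/-- Conditionals are expressions, so that the piecewise definitions of the shifts translate term by
term and `eval_arcShiftArith` holds by definition. -/
inductive Arith where
  | lit (n : ℕ)
  | var (x : Fin 20)
  | add (e f : Arith)
  | sub (e f : Arith)
  | load (a : ℕ) (idx : List (Fin 20))
  | ifLt (e f g h : Arith)
  | ifEq (e f g h : Arith)

def Arith.eval (a : Mem) : Arith → ℕ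
  | .lit n => n
  | .var x => a.env x
  | .add e f => e.eval a + f.eval a
  | .sub e f => e.eval a - f.eval a
  | .load b idx => a.arr b (idx.map a.env)
  | .ifLt e f g h => if e.eval a < f.eval a then g.eval a else h.eval a
  | .ifEq e f g h => if e.eval a = f.eval a then g.eval a else h.eval a

/-- Both branches of a conditional are counted, which makes the bound independent of the store. -/
def Arith.cost : Arith → ℕ
  | .lit _ => 1
  | .var _ => 1
  | .add e f => e.cost + f.cost + 1
  | .sub e f => e.cost + f.cost + 1
  | .load _ idx => idx.length + 1
  | .ifLt e f g h => e.cost + f.cost + g.cost + h.cost + 1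
  | .ifEq e f g h => e.cost + f.cost + g.cost + h.cost + 1

/-- Evaluate the expression into register `t`, using only registers from `t` on. -/
def Arith.compile : Arith → ℕ → Prog
  | .lit n, t => .const t n
  | .var x, t => .copy t x
  | .add e f, t => .seq (e.compile t) (.seq (f.compile (t + 1)) (.add t t (t + 1)))
  | .sub e f, t => .seq (e.compile t) (.seq (f.compile (t + 1)) (.sub t t (t + 1)))
  | .load b idx, t => .load t b (idx.map Fin.val)
  | .ifLt e f g h, t => .seq (e.compile t) (.seq (f.compile (t + 1))
      (.ite (.lt t (t + 1)) (g.compile t) (h.compile t)))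
  | .ifEq e f g h, t => .seq (e.compile t) (.seq (f.compile (t + 1))
      (.ite (.eq t (t + 1)) (g.compile t) (h.compile t)))

theorem Store.mem_congr {s s' : Store} {t : ℕ} (ht : 20 ≤ t) (h : ∀ x < t, s'.var x = s.var x)
    (h' : s'.arr = s.arr) : s'.mem = s.mem := by
  ext x
  · exact h x (by omega)
  · simp [Store.mem, h']

/-- `e.compile t` evaluates `e` into register `t` and leaves the lower registers alone. -/
def Arith.Compiles (e : Arith) : Prop :=
  ∀ (t : ℕ) (_ : 20 ≤ t) (s : Store), ∃ s' c, Exec (e.compile t) s s' c ∧ c ≤ e.cost ∧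
    s'.var t = e.eval s.mem ∧ (∀ x < t, s'.var x = s.var x) ∧ s'.arr = s.arr

theorem Arith.compile_two {e f : Arith} (he : e.Compiles) (hf : f.Compiles) (t : ℕ) (ht : 20 ≤ t)
    (s : Store) : ∃ s₁ s₂ c₁ c₂, Exec (e.compile t) s s₁ c₁ ∧ Exec (f.compile (t + 1)) s₁ s₂ c₂ ∧
      c₁ ≤ e.cost ∧ c₂ ≤ f.cost ∧ s₂.var t = e.eval s.mem ∧ s₂.var (t + 1) = f.eval s.mem ∧
      (∀ x < t, s₂.var x = s.var x) ∧ s₂.arr = s.arr := by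
  obtain ⟨s₁, c₁, h₁, hc₁, hv₁, hx₁, ha₁⟩ := he t ht s
  obtain ⟨s₂, c₂, h₂, hc₂, hv₂, hx₂, ha₂⟩ := hf (t + 1) (by omega) s₁
  have hm : s₁.mem = s.mem := Store.mem_congr ht hx₁ ha₁
  refine ⟨s₁, s₂, c₁, c₂, h₁, h₂, hc₁, hc₂, ?_, ?_, fun x hx => ?_, ha₂.trans ha₁⟩
  · rw [hx₂ t (by omega), hv₁]
  · rw [hv₂, hm]
  · rw [hx₂ x (by omega), hx₁ x hx]

theorem Arith.compile_ite {s s₂ : Store} {g h : Arith} {t : ℕ} (ht : 20 ≤ t) (b : Test)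
    (hg : g.Compiles) (hh : h.Compiles) (hx : ∀ x < t, s₂.var x = s.var x)
    (ha : s₂.arr = s.arr) : ∃ s' c, Exec (.ite b (g.compile t) (h.compile t)) s₂ s' c ∧
      c ≤ g.cost + h.cost + 1 ∧ (b.Holds s₂ → s'.var t = g.eval s.mem) ∧
      (¬ b.Holds s₂ → s'.var t = h.eval s.mem) ∧ (∀ x < t, s'.var x = s.var x) ∧
      s'.arr = s.arr := by
  have hm : s₂.mem = s.mem := Store.mem_congr ht hx ha
  by_cases hb : b.Holds s₂
  · obtain ⟨s', c, h₁, hc, hv, hx', ha'⟩ := hg t ht s₂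
    exact ⟨s', c + 1, .iteTrue hb h₁, by omega, fun _ => by rw [hv, hm], fun h => (h hb).elim,
      fun x hxt => by rw [hx' x hxt, hx x hxt], ha'.trans ha⟩
  · obtain ⟨s', c, h₁, hc, hv, hx', ha'⟩ := hh t ht s₂
    exact ⟨s', c + 1, .iteFalse hb h₁, by omega, fun h => (hb h).elim, fun _ => by rw [hv, hm],
      fun x hxt => by rw [hx' x hxt, hx x hxt], ha'.trans ha⟩

theorem Store.setVar_var_of_lt {s s' : Store} {t v : ℕ} (h : ∀ x < t, s'.var x = s.var x) :
    ∀ x < t, (s'.setVar t v).var x = s.var x := fun x hx => by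
  simp [Store.setVar, Function.update_of_ne hx.ne, h x hx]

theorem Arith.compiles (e : Arith) : e.Compiles := by
  induction e with
  | lit n =>
    exact fun t _ s => ⟨_, _, .const s t n, le_rfl, by simp [Store.setVar, eval],
      Store.setVar_var_of_lt fun _ _ => rfl, rfl⟩
  | var x =>
    exact fun t _ s => ⟨_, _, .copy s t x, le_rfl, by simp [Store.setVar, eval, Store.mem],
      Store.setVar_var_of_lt fun _ _ => rfl, rfl⟩
  | load b idx =>
    refine fun t _ s => ⟨_, _, .load s t b (idx.map Fin.val), by simp [cost], ?_,
      Store.setVar_var_of_lt fun _ _ => rfl, rfl⟩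
    simp only [Store.setVar, Function.update_self, eval, Store.mem, List.map_map]
    rfl
  | add e f he hf =>
    intro t ht s
    obtain ⟨s₁, s₂, c₁, c₂, h₁, h₂, hc₁, hc₂, hv₁, hv₂, hx, ha⟩ := compile_two he hf t ht s
    exact ⟨_, _, .seq h₁ (.seq h₂ (.add s₂ t t (t + 1))), by simp only [cost]; omega,
      by simp [Store.setVar, eval, hv₁, hv₂], Store.setVar_var_of_lt hx, ha⟩
  | sub e f he hf =>
    intro t ht s
    obtain ⟨s₁, s₂, c₁, c₂, h₁, h₂, hc₁, hc₂, hv₁, hv₂, hx, ha⟩ := compile_two he hf t ht s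
    exact ⟨_, _, .seq h₁ (.seq h₂ (.sub s₂ t t (t + 1))), by simp only [cost]; omega,
      by simp [Store.setVar, eval, hv₁, hv₂], Store.setVar_var_of_lt hx, ha⟩
  | ifLt e f g h he hf hg hh =>
    intro t ht s
    obtain ⟨s₁, s₂, c₁, c₂, h₁, h₂, hc₁, hc₂, hv₁, hv₂, hx, ha⟩ := compile_two he hf t ht s
    obtain ⟨s', c, h₃, hc, htrue, hfalse, hx', ha'⟩ :=
      compile_ite ht (.lt t (t + 1)) hg hh hx ha
    simp only [Test.Holds, hv₁, hv₂] at htrue hfalse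
    refine ⟨_, _, .seq h₁ (.seq h₂ h₃), by simp only [cost]; omega, ?_, hx', ha'⟩
    simp only [eval]
    split_ifs with hb
    exacts [htrue hb, hfalse hb]
  | ifEq e f g h he hf hg hh =>
    intro t ht s
    obtain ⟨s₁, s₂, c₁, c₂, h₁, h₂, hc₁, hc₂, hv₁, hv₂, hx, ha⟩ := compile_two he hf t ht s
    obtain ⟨s', c, h₃, hc, htrue, hfalse, hx', ha'⟩ :=
      compile_ite ht (.eq t (t + 1)) hg hh hx ha
    simp only [Test.Holds, hv₁, hv₂] at htrue hfalse
    refine ⟨_, _, .seq h₁ (.seq h₂ h₃), by simp only [cost]; omega, ?_, hx', ha'⟩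
    simp only [eval]
    split_ifs with hb
    exacts [htrue hb, hfalse hb]

/-! ### Hoare triples with running times -/

/-- From every store satisfying `P`, the program halts within `T` steps in a store
satisfying `Q`. -/
def Hoare (P : Mem → Prop) (c : Prog) (Q : Mem → Prop) (T : ℕ) : Prop :=
  ∀ s : Store, P s.mem → ∃ s' t, Exec c s s' t ∧ t ≤ T ∧ Q s'.mem

theorem Hoare.consequence {P P' Q Q' : Mem → Prop} {c : Prog} {T T' : ℕ} (h : Hoare P c Q T)
    (hP : ∀ a, P' a → P a) (hQ : ∀ a, Q a → Q' a) (hT : T ≤ T') : Hoare P' c Q' T' := by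
  intro s hs
  obtain ⟨s', t, he, ht, hq⟩ := h s (hP _ hs)
  exact ⟨s', t, he, ht.trans hT, hQ _ hq⟩

theorem Hoare.seq {P Q R : Mem → Prop} {c d : Prog} {T T' : ℕ} (h : Hoare P c Q T)
    (h' : Hoare Q d R T') : Hoare P (.seq c d) R (T + T') := by
  intro s hs
  obtain ⟨s', t, he, ht, hq⟩ := h s hs
  obtain ⟨s'', t', he', ht', hr⟩ := h' s' hq
  exact ⟨s'', t + t', .seq he he', by omega, hr⟩

def assign (x : Fin 20) (e : Arith) : Prog :=
  .seq (e.compile 20) (.copy x 20)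

theorem Hoare.assign (x : Fin 20) (e : Arith) (Q : Mem → Prop) :
    Hoare (fun a => Q (a.set x (e.eval a))) (assign x e) Q (e.cost + 1) := by
  intro s hs
  obtain ⟨s', c, h, hc, hv, hx, ha⟩ := e.compiles 20 le_rfl s
  refine ⟨_, _, .seq h (.copy s' x 20), by omega, ?_⟩
  rwa [Store.mem_setVar, hv, Store.mem_congr le_rfl hx ha]

def write (b : ℕ) (idx : List (Fin 20)) (e : Arith) : Prog :=
  .seq (e.compile 20) (.store b (idx.map Fin.val) 20)

theorem Hoare.write (b : ℕ) (idx : List (Fin 20)) (e : Arith) (Q : Mem → Prop) :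
    Hoare (fun a => Q (a.put b (idx.map a.env) (e.eval a))) (write b idx e) Q
      (e.cost + idx.length + 1) := by
  intro s hs
  obtain ⟨s', c, h, hc, hv, hx, ha⟩ := e.compiles 20 le_rfl s
  refine ⟨_, _, .seq h (.store s' b (idx.map Fin.val) 20), by simp; omega, ?_⟩
  have hm := Store.mem_congr le_rfl hx ha
  rw [← hm] at hs hv
  convert hs using 1
  simp only [Store.mem, Store.setArr, Mem.put, List.map_map, hv]
  rfl

theorem Hoare.ite {P Q : Mem → Prop} {c d : Prog} {T T' : ℕ} (x y : Fin 20)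
    (h : Hoare (fun a => P a ∧ a.env x = a.env y) c Q T)
    (h' : Hoare (fun a => P a ∧ a.env x ≠ a.env y) d Q T') :
    Hoare P (.ite (.eq x y) c d) Q (T + T' + 1) := by
  intro s hs
  by_cases hb : s.var x = s.var y
  · obtain ⟨s', t, he, ht, hq⟩ := h s ⟨hs, hb⟩
    exact ⟨s', _, .iteTrue hb he, by omega, hq⟩
  · obtain ⟨s', t, he, ht, hq⟩ := h' s ⟨hs, hb⟩
    exact ⟨s', _, .iteFalse hb he, by omega, hq⟩

/-- The variant `f` drops in each round, so there are at most `N` rounds; the extra summand pays for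
the final failing test. -/
theorem Hoare.while {P : Mem → Prop} {c : Prog} {T : ℕ} (x y : Fin 20) (f : Mem → ℕ)
    (h : ∀ N, Hoare (fun a => P a ∧ a.env x < a.env y ∧ f a = N) c
      (fun a => P a ∧ f a < N) T) (N : ℕ) :
    Hoare (fun a => P a ∧ f a ≤ N) (.while (.lt x y) c)
      (fun a => P a ∧ ¬ a.env x < a.env y) ((N + 1) * (T + 1)) := by
  induction N with
  | zero =>
    rintro s ⟨hs, hf⟩
    have hb : ¬ s.var x < s.var y := by
      intro hb
      obtain ⟨s', t, -, -, -, hlt⟩ := h _ s ⟨hs, hb, rfl⟩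
      omega
    exact ⟨s, _, .whileFalse hb, by omega, hs, hb⟩
  | succ N ih =>
    rintro s ⟨hs, hf⟩
    by_cases hb : s.var x < s.var y
    · obtain ⟨s', t, he, ht, hs', hlt⟩ := h _ s ⟨hs, hb, rfl⟩
      obtain ⟨s'', t', he', ht', hq⟩ := ih s' ⟨hs', by omega⟩
      exact ⟨s'', _, .whileTrue hb he he', by rw [Nat.succ_mul]; omega, hq⟩
    · exact ⟨s, _, .whileFalse hb, by nlinarith, hs, hb⟩

/-! ### Counting loops -/

/-- Outside the set `M` of scratch registers, the registers have the values `ρ`. -/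
def Mem.Agrees (a : Mem) (ρ : Fin 20 → ℕ) (M : Finset (Fin 20)) : Prop :=
  ∀ x ∉ M, a.env x = ρ x

/-- Started with registers `ρ`, the program extends the set `R` of items that have been dealt
with by `C`; here `Φ R` says that the items in `R` have been dealt with. -/
def Progress {α : Type*} (Φ : Set α → Mem → Prop) (M : Finset (Fin 20)) (ρ : Fin 20 → ℕ)
    (c : Prog) (C : Set α) (T : ℕ) : Prop :=
  ∀ R, Hoare (fun a => a.Agrees ρ M ∧ Φ R a) c (fun a => a.Agrees ρ M ∧ Φ (R ∪ C) a) T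

def forLoop (x y : Fin 20) (c : Prog) : Prog :=
  .seq (assign x (.lit 0)) (.while (.lt x y) (.seq c (assign x (.add (.var x) (.lit 1)))))

theorem Mem.Agrees.set {a : Mem} {ρ : Fin 20 → ℕ} {M : Finset (Fin 20)} {x : Fin 20}
    (h : a.Agrees ρ (insert x M)) (v : ℕ) : (a.set x v).Agrees (Function.update ρ x v) M := by
  intro z hz
  by_cases hzx : z = x
  · subst hzx; simp [Mem.set]
  · simp [Mem.set, Function.update_of_ne hzx, h z (by simp [hzx, hz])]

theorem Mem.Agrees.forget {a : Mem} {ρ : Fin 20 → ℕ} {M : Finset (Fin 20)} {x : Fin 20} {v : ℕ}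
    (h : a.Agrees (Function.update ρ x v) M) : a.Agrees ρ (insert x M) := by
  intro z hz
  simp only [Finset.mem_insert, not_or] at hz
  rw [h z hz.2, Function.update_of_ne hz.1]

/-- For the body the counter is a constant, part of the register values `Function.update ρ x i`;
only the whole loop counts it as scratch. This allows loops to be nested without restating
invariants. -/
theorem Progress.forLoop {α : Type*} {Φ : Set α → Mem → Prop} {M : Finset (Fin 20)}
    {ρ : Fin 20 → ℕ} {c : Prog} {C : ℕ → Set α} {T N : ℕ} {x y : Fin 20} (hx : x ∉ M)
    (hy : y ∉ insert x M) (hΦ : ∀ R a v, Φ R a → Φ R (a.set x v)) (hN : ρ y ≤ N)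
    (h : ∀ i < ρ y, Progress Φ M (Function.update ρ x i) c (C i) T) :
    Progress Φ (insert x M) ρ (forLoop x y c) {p | ∃ i < ρ y, p ∈ C i} (N * (T + 5) + 3) := by
  intro R
  have hyM : y ∉ M := fun hm => hy (Finset.mem_insert_of_mem hm)
  have hyx : y ≠ x := fun hm => hy (hm ▸ Finset.mem_insert_self _ _)
  -- Induction on the number `j` of rounds still to come.
  have key : ∀ j i, i + j = ρ y → Hoare
      (fun a => a.Agrees (Function.update ρ x i) M ∧ Φ (R ∪ {p | ∃ i' < i, p ∈ C i'}) a)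
      (.while (.lt x y) (.seq c (StrongPacking.assign x (.add (.var x) (.lit 1)))))
      (fun a => a.Agrees ρ (insert x M) ∧ Φ (R ∪ {p | ∃ i < ρ y, p ∈ C i}) a)
      (j * (T + 5) + 1) := by
    intro j
    induction j with
    | zero =>
      rintro i hi s ⟨ha, hs⟩
      have hb : ¬ s.var x < s.var y := by
        have h1 := ha x hx
        have h2 := ha y hyM
        simp only [Function.update_self, Function.update_of_ne hyx, Store.mem] at h1 h2
        omega
      refine ⟨s, _, .whileFalse hb, by omega, ha.forget, ?_⟩
      rwa [← hi]
    | succ j ih =>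
      rintro i hi s ⟨ha, hs⟩
      have hb : s.var x < s.var y := by
        have h1 := ha x hx
        have h2 := ha y hyM
        simp only [Function.update_self, Function.update_of_ne hyx, Store.mem] at h1 h2
        omega
      obtain ⟨s', t, he, ht, ha', hs'⟩ := h i (by omega) _ s ⟨ha, hs⟩
      obtain ⟨s'', t', he', ht', ha'', hs''⟩ := Hoare.assign x (.add (.var x) (.lit 1))
        (fun a => a.Agrees (Function.update ρ x (i + 1)) M ∧
          Φ (R ∪ {p | ∃ i' < i + 1, p ∈ C i'}) a) s' (by
          have hv : s'.mem.env x = i := by simpa using ha' x hx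
          simp only [Arith.eval, hv]
          refine ⟨ha'.forget.set _, hΦ _ _ _ ?_⟩
          convert hs' using 1
          ext p
          simp only [Set.mem_union, Set.mem_ofPred_eq, Nat.lt_succ_iff_lt_or_eq, or_and_right,
            exists_or, exists_eq_left, or_assoc])
      obtain ⟨s''', t'', he'', ht'', hq⟩ := ih (i + 1) (by omega) s'' ⟨ha'', hs''⟩
      simp only [Arith.cost] at ht'
      exact ⟨s''', _, .whileTrue hb (.seq he he') he'', by rw [Nat.succ_mul]; omega, hq⟩
  refine (Hoare.seq (Hoare.assign x (.lit 0) _) (key (ρ y) 0 (by omega))).consequence ?_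
    (fun _ h => h) ?_
  · rintro a ⟨ha, hs⟩
    refine ⟨ha.set _, hΦ _ _ _ ?_⟩
    convert hs using 1
    simp
  · simp only [Arith.cost]
    have := Nat.mul_le_mul_right (T + 5) hN
    omega

theorem Progress.seq {α : Type*} {Φ : Set α → Mem → Prop} {M : Finset (Fin 20)}
    {ρ : Fin 20 → ℕ} {c d : Prog} {C D : Set α} {T T' : ℕ} (h : Progress Φ M ρ c C T)
    (h' : Progress Φ M ρ d D T') : Progress Φ M ρ (.seq c d) (C ∪ D) (T + T') := by
  intro R
  have := (h R).seq (h' (R ∪ C))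
  rwa [Set.union_assoc] at this

/-- A register may be given a value first. -/
theorem Progress.bind {α : Type*} {Φ : Set α → Mem → Prop} {M : Finset (Fin 20)}
    {ρ : Fin 20 → ℕ} {c d : Prog} {D : Set α} {x : Fin 20} {v T T' : ℕ}
    (h : ∀ R, Hoare (fun a => a.Agrees ρ (insert x M) ∧ Φ R a) c
      (fun a => a.Agrees (Function.update ρ x v) M ∧ Φ R a) T)
    (h' : Progress Φ M (Function.update ρ x v) d D T') :
    Progress Φ (insert x M) ρ (.seq c d) D (T + T') := fun R =>
  ((h R).seq (h' R)).consequence (fun _ h => h) (fun _ h => ⟨h.1.forget, h.2⟩) le_rfl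

/-! ### Arrays of shifts -/

def addMod (m b s : ℕ) : ℕ :=
  if b + s < m then b + s else b + s - m

/-- Row `k` shifts by `k`, except that, if `m` is congruent to `2` modulo `4` and `m ≠ 2`, the four
rows with index `-2`, `-1`, `0`, `1` modulo `m` are rearranged in each column `b`.  Here
`m₄` and `b₄` are the residues of `m` and `b` modulo `4`. -/
def firstShift (m m₄ k b b₄ : ℕ) : ℕ :=
  if m₄ = 2 then
    if 2 < m then
      if k + 2 = m then
        if b < 3 then m - 1 else if b = 3 then 0 else
        if b₄ = 1 then m - 1 else if b₄ = 2 then 1 else m - 2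
      else if k + 1 = m then
        if b = 2 then 1 else if b = 3 then m - 1 else 0
      else if k = 0 then
        if b < 4 then if b = 1 then m - 2 else if b = 2 then 0 else 1
        else if b₄ = 0 then m - 1 else if b₄ = 2 then m - 1 else 1
      else if k = 1 then
        if b < 4 then if b = 1 then 1 else m - 2
        else if b₄ = 0 then 1 else if b₄ = 3 then m - 1 else m - 2
      else k
    else k
  else k

/-- Here `h` is the integral part of `m / 2`. -/
def secondShift (m h k : ℕ) : ℕ :=
  if h + h = m then if k = 0 then h else if k < h + 1 then k - 1 else k else k

def thirdShift (m h k : ℕ) : ℕ :=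
  if k = 0 then 1 else if k < h + 1 then h + h + 2 - (k + k) else m + m + 1 - (k + k)

def swapShift (m k : ℕ) : ℕ :=
  if k < 2 then 1 - k else m + 1 - k

/-! ### Ranges and injectivity of the shifts -/

theorem addMod_lt {m b s : ℕ} (hb : b < m) (hs : s ≤ m) : addMod m b s < m := by
  unfold addMod; split_ifs <;> omega

theorem addMod_left_inj {m b b' s : ℕ} (hb : b < m) (hb' : b' < m)
    (h : addMod m b s = addMod m b' s) : b = b' := by
  unfold addMod at h; split_ifs at h <;> omega

/-- Shifts up to and including `m` occur, and `0` and `m` act alike; no other coincidence is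
possible. -/
theorem addMod_right {m b s s' : ℕ} (hs : s ≤ m) (hs' : s' ≤ m)
    (h : addMod m b s = addMod m b s') : s = s' ∨ (s = 0 ∧ s' = m) ∨ (s = m ∧ s' = 0) := by
  unfold addMod at h; split_ifs at h <;> omega

theorem addMod_spec (m b s : ℕ) :
    (b + s < m ∧ addMod m b s = b + s) ∨ (m ≤ b + s ∧ addMod m b s = b + s - m) := by
  unfold addMod; split_ifs <;> omega

theorem firstShift_of_not {m k : ℕ} (b : ℕ)
    (h : ¬ ((m % 4 = 2 ∧ 2 < m) ∧ (k + 2 = m ∨ k + 1 = m ∨ k = 0 ∨ k = 1))) :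
    firstShift m (m % 4) k b (b % 4) = k := by
  unfold firstShift; split_ifs <;> first | rfl | omega

theorem firstShift_lt {m k : ℕ} (b : ℕ) (hk : k < m) : firstShift m (m % 4) k b (b % 4) < m := by
  unfold firstShift; split_ifs <;> omega

theorem secondShift_lt {m k : ℕ} (hk : k < m) : secondShift m (m / 2) k < m := by
  unfold secondShift; split_ifs <;> omega

theorem thirdShift_le {m k : ℕ} (hk : k < m) : thirdShift m (m / 2) k ≤ m := by
  unfold thirdShift; split_ifs <;> omega

theorem swapShift_le {m k : ℕ} (hk : k < m) : swapShift m k ≤ m := by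
  unfold swapShift; split_ifs <;> omega

/-- The first shift in the rearranged rows. -/
theorem firstShift_cases {m b : ℕ} (hm : m % 4 = 2) (hm' : 2 < m) :
    (firstShift m (m % 4) (m - 2) b (b % 4) =
      if b < 3 then m - 1 else if b = 3 then 0 else
        if b % 4 = 1 then m - 1 else if b % 4 = 2 then 1 else m - 2) ∧
    (firstShift m (m % 4) (m - 1) b (b % 4) =
      if b = 2 then 1 else if b = 3 then m - 1 else 0) ∧
    (firstShift m (m % 4) 0 b (b % 4) =
      if b < 4 then if b = 1 then m - 2 else if b = 2 then 0 else 1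
        else if b % 4 = 0 then m - 1 else if b % 4 = 2 then m - 1 else 1) ∧
    (firstShift m (m % 4) 1 b (b % 4) =
      if b < 4 then if b = 1 then 1 else m - 2
        else if b % 4 = 0 then 1 else if b % 4 = 3 then m - 1 else m - 2) := by
  refine ⟨?_, ?_, ?_, ?_⟩ <;> unfold firstShift <;> rw [if_pos hm, if_pos hm']
  · rw [if_pos (by omega)]
  · rw [if_neg (by omega), if_pos (by omega)]
  · rw [if_neg (by omega), if_neg (by omega), if_pos rfl]
  · rw [if_neg (by omega), if_neg (by omega), if_neg (by omega), if_pos rfl]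

/-! ### The four rearranged rows as explicit permutations -/

section Rearranged

variable {m b : ℕ}

theorem firstShift_row_neg_two (hm : m % 4 = 2) (hm' : 2 < m) (hb : b < m) :
    ∃ x, addMod m b (firstShift m (m % 4) (m - 2) b (b % 4)) = x ∧
      ((b = 0 ∧ x = m - 1) ∨ (b = 1 ∧ x = 0) ∨ (b = 2 ∧ x = 1) ∨ (b = 3 ∧ x = 3) ∨
      (4 ≤ b ∧ b % 4 = 0 ∧ x = b - 2) ∨ (4 ≤ b ∧ b % 4 = 1 ∧ x = b - 1) ∨
      (4 ≤ b ∧ b % 4 = 2 ∧ x = b + 1) ∨ (4 ≤ b ∧ b % 4 = 3 ∧ x = b - 2)) := by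
  have := addMod_spec m b (firstShift m (m % 4) (m - 2) b (b % 4))
  refine ⟨_, rfl, ?_⟩
  generalize addMod m b _ = x at *
  rw [(firstShift_cases hm hm').1] at this
  rcases (by omega : b = 0 ∨ b = 1 ∨ b = 2 ∨ b = 3 ∨ (4 ≤ b ∧ b % 4 = 0) ∨
    (4 ≤ b ∧ b % 4 = 1) ∨ (4 ≤ b ∧ b % 4 = 2) ∨ (4 ≤ b ∧ b % 4 = 3)) with
    hb' | hb' | hb' | hb' | hb' | hb' | hb' | hb'
  all_goals
    split_ifs at this <;> first
      | (exfalso; omega)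
      | ((repeat first | (refine Or.inl ?_; omega) | refine Or.inr ?_) <;> omega)

theorem firstShift_row_neg_one (hm : m % 4 = 2) (hm' : 2 < m) (hb : b < m) :
    ∃ x, addMod m b (firstShift m (m % 4) (m - 1) b (b % 4)) = x ∧
      ((b = 2 ∧ x = 3) ∨ (b = 3 ∧ x = 2) ∨ (b ≠ 2 ∧ b ≠ 3 ∧ x = b)) := by
  have := addMod_spec m b (firstShift m (m % 4) (m - 1) b (b % 4))
  refine ⟨_, rfl, ?_⟩
  generalize addMod m b _ = x at *
  rw [(firstShift_cases hm hm').2.1] at this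
  rcases (by omega : b = 0 ∨ b = 1 ∨ b = 2 ∨ b = 3 ∨ (4 ≤ b ∧ b % 4 = 0) ∨
    (4 ≤ b ∧ b % 4 = 1) ∨ (4 ≤ b ∧ b % 4 = 2) ∨ (4 ≤ b ∧ b % 4 = 3)) with
    hb' | hb' | hb' | hb' | hb' | hb' | hb' | hb'
  all_goals
    split_ifs at this <;> first
      | (exfalso; omega)
      | ((repeat first | (refine Or.inl ?_; omega) | refine Or.inr ?_) <;> omega)

theorem firstShift_row_zero (hm : m % 4 = 2) (hm' : 2 < m) (hb : b < m) :
    ∃ x, addMod m b (firstShift m (m % 4) 0 b (b % 4)) = x ∧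
      ((b = 0 ∧ x = 1) ∨ (b = 1 ∧ x = m - 1) ∨ (b = 2 ∧ x = 2) ∨ (b = 3 ∧ x = 4) ∨
      (4 ≤ b ∧ b % 2 = 0 ∧ x = b - 1) ∨
      (4 ≤ b ∧ b % 2 = 1 ∧ (b + 1 < m ∧ x = b + 1 ∨ b + 1 = m ∧ x = 0))) := by
  have := addMod_spec m b (firstShift m (m % 4) 0 b (b % 4))
  refine ⟨_, rfl, ?_⟩
  generalize addMod m b _ = x at *
  rw [(firstShift_cases hm hm').2.2.1] at this
  rcases (by omega : b = 0 ∨ b = 1 ∨ b = 2 ∨ b = 3 ∨ (4 ≤ b ∧ b % 4 = 0) ∨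
    (4 ≤ b ∧ b % 4 = 1) ∨ (4 ≤ b ∧ b % 4 = 2) ∨ (4 ≤ b ∧ b % 4 = 3)) with
    hb' | hb' | hb' | hb' | hb' | hb' | hb' | hb'
  all_goals
    split_ifs at this <;> first
      | (exfalso; omega)
      | ((repeat first | (refine Or.inl ?_; omega) | refine Or.inr ?_) <;> omega)

theorem firstShift_row_one (hm : m % 4 = 2) (hm' : 2 < m) (hb : b < m) :
    ∃ x, addMod m b (firstShift m (m % 4) 1 b (b % 4)) = x ∧
      ((b = 0 ∧ x = m - 2) ∨ (b = 1 ∧ x = 2) ∨ (b = 2 ∧ x = 0) ∨ (b = 3 ∧ x = 1) ∨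
      (4 ≤ b ∧ b % 4 = 0 ∧ x = b + 1) ∨ (4 ≤ b ∧ (b % 4 = 1 ∨ b % 4 = 2) ∧ x = b - 2) ∨
      (4 ≤ b ∧ b % 4 = 3 ∧ x = b - 1)) := by
  have := addMod_spec m b (firstShift m (m % 4) 1 b (b % 4))
  refine ⟨_, rfl, ?_⟩
  generalize addMod m b _ = x at *
  rw [(firstShift_cases hm hm').2.2.2] at this
  rcases (by omega : b = 0 ∨ b = 1 ∨ b = 2 ∨ b = 3 ∨ (4 ≤ b ∧ b % 4 = 0) ∨
    (4 ≤ b ∧ b % 4 = 1) ∨ (4 ≤ b ∧ b % 4 = 2) ∨ (4 ≤ b ∧ b % 4 = 3)) with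
    hb' | hb' | hb' | hb' | hb' | hb' | hb' | hb'
  all_goals
    split_ifs at this <;> first
      | (exfalso; omega)
      | ((repeat first | (refine Or.inl ?_; omega) | refine Or.inr ?_) <;> omega)

end Rearranged

/-- This gives disjointness: in every column `b` the four special rows carry the values `m - 2`, `m
- 1`, `0`, `1` in some order, so the shifts of a column remain a permutation. -/
theorem addMod_firstShift_inj {m k k' b : ℕ} (hk : k < m) (hk' : k' < m)
    (h : addMod m b (firstShift m (m % 4) k b (b % 4)) =
      addMod m b (firstShift m (m % 4) k' b (b % 4))) : k = k' := by
  replace h : firstShift m (m % 4) k b (b % 4) = firstShift m (m % 4) k' b (b % 4) := by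
    have := addMod_right (firstShift_lt b hk).le (firstShift_lt b hk').le h
    have := firstShift_lt b hk
    have := firstShift_lt b hk'
    omega
  by_cases hm : m % 4 = 2 ∧ 2 < m
  swap
  · rwa [firstShift_of_not b fun h => hm h.1, firstShift_of_not b fun h => hm h.1] at h
  obtain ⟨hm, hm'⟩ := hm
  obtain ⟨e₁, e₂, e₃, e₄⟩ := firstShift_cases (b := b) hm hm'
  rcases (by omega : k = m - 2 ∨ k = m - 1 ∨ k = 0 ∨ k = 1 ∨ (2 ≤ k ∧ k + 2 < m)) with
      c | c | c | c | c <;>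
    rcases (by omega : k' = m - 2 ∨ k' = m - 1 ∨ k' = 0 ∨ k' = 1 ∨ (2 ≤ k' ∧ k' + 2 < m)) with
      c' | c' | c' | c' | c' <;>
    first
    | exact c.trans c'.symm
    | (first | rw [c] at h | rw [firstShift_of_not b (by omega)] at h
       first | rw [c'] at h | rw [firstShift_of_not (k := k') b (by omega)] at h
       try simp only [e₁, e₂, e₃, e₄] at h
       clear e₁ e₂ e₃ e₄
       first | omega | (split_ifs at h <;> omega))

theorem addMod_secondShift_inj {m k k' b : ℕ} (hk : k < m) (hk' : k' < m) 
    (h : addMod m b (secondShift m (m / 2) k) = addMod m b (secondShift m (m / 2) k')) :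
    k = k' := by
  have := addMod_right (secondShift_lt hk).le (secondShift_lt hk').le h
  have h₁ := secondShift_lt hk
  have h₂ := secondShift_lt hk'
  replace h : secondShift m (m / 2) k = secondShift m (m / 2) k' := by omega
  unfold secondShift at h; split_ifs at h <;> omega

theorem addMod_thirdShift_inj {m k k' b : ℕ} (hk : k < m) (hk' : k' < m) 
    (h : addMod m b (thirdShift m (m / 2) k) = addMod m b (thirdShift m (m / 2) k')) :
    k = k' := by
  -- The third shift attains the value `m` but never `0`, so the coincidence of these two does not
  -- arise.
  have pos : ∀ k < m, 0 < thirdShift m (m / 2) k := by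
    intro k hk; unfold thirdShift; split_ifs <;> omega
  have := addMod_right (thirdShift_le hk) (thirdShift_le hk') h
  have h₁ := pos k hk
  have h₂ := pos k' hk'
  replace h : thirdShift m (m / 2) k = thirdShift m (m / 2) k' := by omega
  unfold thirdShift at h; split_ifs at h <;> omega

theorem addMod_swapShift_inj {m k k' b : ℕ} (hk : k < m) (hk' : k' < m) (hb : b < m)
    (h : addMod m b (swapShift m k) = addMod m b (swapShift m k')) : k = k' := by
  unfold addMod swapShift at h; split_ifs at h <;> omega

/-- This makes each row a perfect matching. It is not automatic in the rearranged rows, where the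
shift varies with `b`. -/
theorem addMod_firstShift_left_inj {m k b b' : ℕ} (hb : b < m) (hb' : b' < m)
    (h : addMod m b (firstShift m (m % 4) k b (b % 4)) =
      addMod m b' (firstShift m (m % 4) k b' (b' % 4))) : b = b' := by
  by_cases hm : (m % 4 = 2 ∧ 2 < m) ∧ (k + 2 = m ∨ k + 1 = m ∨ k = 0 ∨ k = 1)
  · obtain ⟨⟨hm, hm'⟩, hk'⟩ := hm
    rcases (by omega : k = m - 2 ∨ k = m - 1 ∨ k = 0 ∨ k = 1) with rfl | rfl | rfl | rfl
    · obtain ⟨x, e, hx⟩ := firstShift_row_neg_two hm hm' hb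
      obtain ⟨x', e', hx'⟩ := firstShift_row_neg_two hm hm' hb'
      rw [e, e'] at h
      clear e e'
      omega
    · obtain ⟨x, e, hx⟩ := firstShift_row_neg_one hm hm' hb
      obtain ⟨x', e', hx'⟩ := firstShift_row_neg_one hm hm' hb'
      rw [e, e'] at h
      clear e e'
      omega
    · obtain ⟨x, e, hx⟩ := firstShift_row_zero hm hm' hb
      obtain ⟨x', e', hx'⟩ := firstShift_row_zero hm hm' hb'
      rw [e, e'] at h
      clear e e'
      omega
    · obtain ⟨x, e, hx⟩ := firstShift_row_one hm hm' hb
      obtain ⟨x', e', hx'⟩ := firstShift_row_one hm hm' hb'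
      rw [e, e'] at h
      clear e e'
      omega
  · rw [firstShift_of_not b hm, firstShift_of_not b' hm] at h
    exact addMod_left_inj hb hb' h

/-! ### The composition of the three shifts has a single orbit -/

def lap (m k b : ℕ) : ℕ :=
  addMod m (addMod m (addMod m b (firstShift m (m % 4) k b (b % 4))) (secondShift m (m / 2) k))
    (thirdShift m (m / 2) k)

/-- All numbers below `m` belong to the same orbit of `f`. -/
def Linked (m : ℕ) (f : ℕ → ℕ) : Prop :=
  ∀ E : ℕ → ℕ → Prop, (∀ x y, E x y → E y x) → (∀ x y z, E x y → E y z → E x z) →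
    (∀ b < m, E b (f b)) → ∀ b < m, E b 0

theorem Linked.congr {m : ℕ} {f g : ℕ → ℕ} (hf : Linked m f) (h : ∀ b < m, g b = f b) :
    Linked m g := fun E hs ht hE => hf E hs ht fun b hb => h b hb ▸ hE b hb

theorem linked_succ (m : ℕ) : Linked m fun b => addMod m b 1 := by
  intro E hs ht hE b
  induction b with
  -- `E` is not assumed reflexive, so `E 0 0` comes from going to a neighbour and back.
  | zero => exact fun hb => ht _ _ _ (hE 0 hb) (hs _ _ (hE 0 hb))
  | succ b ih =>
    intro hb
    have := hE b (by omega)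
    simp only [addMod, if_pos hb] at this
    exact ht _ _ _ (hs _ _ this) (ih (by omega))

/-- Modulo `m` the two shifts are `k` and `1 - 2k`, or `k - 1` and `2 - 2k`; both pairs add up to `1
- k`. -/
theorem second_third {m k x : ℕ} (hk : k < m) (hx : x < m) (h : k ≠ 0 ∨ m % 2 = 1) :
    addMod m (addMod m x (secondShift m (m / 2) k)) (thirdShift m (m / 2) k) =
      addMod m x (swapShift m k) := by
  unfold secondShift thirdShift swapShift addMod
  split_ifs <;> omega

theorem second_third_zero {m x : ℕ} (hm : m % 2 = 0) (hx : x < m) :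
    addMod m (addMod m x (secondShift m (m / 2) 0)) (thirdShift m (m / 2) 0) =
      addMod m x (m / 2 + 1) := by
  unfold secondShift thirdShift addMod
  split_ifs <;> omega

/-- Two laps amount to adding `m + 2`, that is `2`, which links numbers of equal parity; since `m /
2 + 1` is odd, a single lap joins the two parity classes. -/
theorem linked_half {m : ℕ} (hm : m % 4 = 0) : Linked m fun b => addMod m b (m / 2 + 1) := by
  intro E hs ht hE
  have step : ∀ b, b + 2 < m → E b (b + 2) := by
    intro b hb
    have h₁ := hE b (by omega)
    have h₂ := hE (addMod m b (m / 2 + 1)) (addMod_lt (by omega) (by omega))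
    have h₃ := addMod_spec m b (m / 2 + 1)
    have h₄ := addMod_spec m (addMod m b (m / 2 + 1)) (m / 2 + 1)
    convert ht _ _ _ h₁ h₂ using 1
    simp only
    omega
  have even : ∀ i, i + i < m → E (i + i) 0 := by
    intro i
    induction i with
    | zero => exact fun h => ht 0 _ 0 (hE 0 h) (hs _ _ (hE 0 h))
    | succ i ih =>
      exact fun h => ht _ (i + i) _
        (hs _ _ (by convert step (i + i) (by omega) using 1; omega)) (ih (by omega))
  have odd : ∀ i, i + i + 1 < m → E (i + i + 1) 1 := by
    intro i
    induction i with
    | zero => exact fun h => ht 1 _ 1 (hE 1 (by omega)) (hs _ _ (hE 1 (by omega)))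
    | succ i ih =>
      exact fun h => ht _ (i + i + 1) _
        (hs _ _ (by convert step (i + i + 1) (by omega) using 1; omega)) (ih (by omega))
  have one (h : 1 < m) : E 1 0 := by
    have h₁ := hE 0 (by omega)
    simp only [addMod, if_pos (show 0 + (m / 2 + 1) < m by omega)] at h₁
    have h₂ := odd (m / 4) (by omega)
    rw [show m / 4 + m / 4 + 1 = 0 + (m / 2 + 1) by omega] at h₂
    exact ht _ _ _ (hs _ _ h₂) (hs _ _ h₁)
  intro b hb
  rcases Nat.even_or_odd' b with ⟨i, rfl | rfl⟩
  · rw [two_mul] at hb ⊢; exact even i hb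
  · rw [two_mul] at hb ⊢; exact ht _ _ _ (odd i hb) (one (by omega))

/-- The rearranged matching followed by adding `3` is the cycle 0, 2, 4, 5, 7, 8, 9, 11, …, m - 1,
1, 3, 6, 10, 14, …, m - 4, 0. The second stretch consists of the numbers from 6 on that are 2 modulo
4. -/
theorem linked_lap_neg_two {m : ℕ} (hm : m % 4 = 2) (hm' : 2 < m) : Linked m (lap m (m - 2)) := by
  intro E hs ht hE
  -- The lap is given as a table of pairs `(b, c)`. To use it, one shows that every `c` which the
  -- table allows for `b` equals `d`, and this is linear arithmetic.
  have edge : ∀ b d, b < m → (∀ c, (b < 3 ∧ c = b + 2) ∨ (b = 3 ∧ 6 < m ∧ c = 6) ∨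
      (b = 3 ∧ m = 6 ∧ c = 0) ∨ (4 ≤ b ∧ b % 4 = 0 ∧ c = b + 1) ∨
      (4 ≤ b ∧ b % 4 = 1 ∧ b + 2 < m ∧ c = b + 2) ∨ (b + 1 = m ∧ c = 1) ∨
      (4 ≤ b ∧ b % 4 = 2 ∧ b + 4 < m ∧ c = b + 4) ∨ (4 ≤ b ∧ b + 4 = m ∧ c = 0) ∨
      (4 ≤ b ∧ b % 4 = 3 ∧ c = b + 1) → c = d) → E b d := by
    intro b d hb hd
    rw [← hd _ ?_]
    · exact hE b hb
    obtain ⟨x, e, hx⟩ := firstShift_row_neg_two hm hm' hb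
    have h3 : swapShift m (m - 2) = 3 := by unfold swapShift; split_ifs <;> omega
    rw [lap, e, second_third (by omega) (by omega) (by omega), h3]
    have := addMod_spec m x 3
    generalize addMod m x 3 = c at *
    clear e hd
    rcases hx with hx | hx | hx | hx | hx | hx | hx | hx <;> rcases this with h | h <;> first
      | (exfalso; omega)
      | ((repeat first | (refine Or.inl ?_; omega) | refine Or.inr ?_) <;> omega)
  have two : E 0 2 := edge 0 2 (by omega) fun c hc => by omega
  have zero : E 0 0 := ht _ _ _ two (hs _ _ two)
  have main : ∀ b < m, b ≠ 1 → b ≠ 3 → (b % 4 = 2 → b = 2) → E b 0 := by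
    intro b
    induction b using Nat.strong_induction_on with
    | _ b ih =>
      intro hb h1 h3 h2
      have prev : ∀ c < b, E c b → c ≠ 1 → c ≠ 3 → (c % 4 = 2 → c = 2) → E b 0 :=
        fun c hc he h1 h3 h2 => ht _ _ _ (hs _ _ he) (ih c hc (by omega) h1 h3 h2)
      rcases (by omega : b = 0 ∨ b = 2 ∨ b = 4 ∨ (5 ≤ b ∧ b % 4 = 1) ∨ (5 ≤ b ∧ b % 4 = 3) ∨
        (8 ≤ b ∧ b % 4 = 0)) with rfl | rfl | rfl | h | h | h
      · exact zero
      · exact hs _ _ two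
      · exact prev 2 (by omega) (edge 2 4 (by omega) fun c hc => by omega) (by omega) (by omega)
          (by omega)
      · exact prev (b - 1) (by omega) (edge _ _ (by omega) fun c hc => by omega) (by omega)
          (by omega) (by omega)
      · exact prev (b - 2) (by omega) (edge _ _ (by omega) fun c hc => by omega) (by omega)
          (by omega) (by omega)
      · exact prev (b - 1) (by omega) (edge _ _ (by omega) fun c hc => by omega) (by omega)
          (by omega) (by omega)
  have one : E 1 0 := ht _ (m - 1) _
    (hs _ _ (edge (m - 1) 1 (by omega) fun c hc => by omega))
    (main (m - 1) (by omega) (by omega) (by omega) (by omega))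
  have three : E 3 0 := ht _ _ _ (hs _ _ (edge 1 3 (by omega) fun c hc => by omega)) one
  have rest : ∀ b < m, b % 4 = 2 → E b 0 := by
    intro b
    induction b using Nat.strong_induction_on with
    | _ b ih =>
      intro hb h2
      rcases (by omega : b = 2 ∨ b = 6 ∨ 10 ≤ b) with rfl | rfl | h
      · exact hs _ _ two
      · exact ht _ _ _ (hs _ _ (edge 3 6 (by omega) fun c hc => by omega)) three
      · exact ht _ _ _ (hs _ _ (edge (b - 4) b (by omega) fun c hc => by omega))
          (ih (b - 4) (by omega) (by omega) (by omega))
  intro b hb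
  by_cases h2 : b % 4 = 2
  · exact rest b hb h2
  by_cases h1 : b = 1
  · exact h1 ▸ one
  by_cases h3 : b = 3
  · exact h3 ▸ three
  exact main b hb h1 h3 fun h => (h2 h).elim

/-- Adding `2` has the even and the odd numbers as orbits; exchanging 2 and 3 first merges them into
0, 2, 5, 7, …, m - 1, 1, 3, 4, 6, …, m - 2, 0. -/
theorem linked_lap_neg_one {m : ℕ} (hm : m % 4 = 2) (hm' : 2 < m) : Linked m (lap m (m - 1)) := by
  intro E hs ht hE
  have edge : ∀ b d, b < m → (∀ c, (b = 2 ∧ c = 5) ∨ (b = 3 ∧ c = 4) ∨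
      (b ≠ 2 ∧ b ≠ 3 ∧ b + 2 < m ∧ c = b + 2) ∨ (m ≤ b + 2 ∧ c = b + 2 - m) → c = d) →
      E b d := by
    intro b d hb hd
    rw [← hd _ ?_]
    · exact hE b hb
    obtain ⟨x, e, hx⟩ := firstShift_row_neg_one hm hm' hb
    have h3 : swapShift m (m - 1) = 2 := by unfold swapShift; split_ifs <;> omega
    rw [lap, e, second_third (by omega) (by omega) (by omega), h3]
    have := addMod_spec m x 2
    generalize addMod m x 2 = c at *
    clear e hd
    rcases hx with hx | hx | hx <;> rcases this with h | h <;> first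
      | (exfalso; omega)
      | ((repeat first | (refine Or.inl ?_; omega) | refine Or.inr ?_) <;> omega)
  have two : E 0 2 := edge 0 2 (by omega) fun c hc => by omega
  have zero : E 0 0 := ht _ _ _ two (hs _ _ two)
  have odd : ∀ b < m, 5 ≤ b → b % 2 = 1 → E b 0 := by
    intro b
    induction b using Nat.strong_induction_on with
    | _ b ih =>
      intro hb h5 h1
      rcases (by omega : b = 5 ∨ 7 ≤ b) with rfl | h
      · exact ht _ _ _ (hs _ _ (edge 2 5 (by omega) fun c hc => by omega)) (hs _ _ two)
      · exact ht _ _ _ (hs _ _ (edge (b - 2) b (by omega) fun c hc => by omega))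
          (ih (b - 2) (by omega) (by omega) (by omega) (by omega))
  have one : E 1 0 := ht _ _ _ (hs _ _ (edge (m - 1) 1 (by omega) fun c hc => by omega))
    (odd (m - 1) (by omega) (by omega) (by omega))
  have three : E 3 0 := ht _ _ _ (hs _ _ (edge 1 3 (by omega) fun c hc => by omega)) one
  have even : ∀ b < m, 4 ≤ b → b % 2 = 0 → E b 0 := by
    intro b
    induction b using Nat.strong_induction_on with
    | _ b ih =>
      intro hb h4 h0
      rcases (by omega : b = 4 ∨ 6 ≤ b) with rfl | h
      · exact ht _ _ _ (hs _ _ (edge 3 4 (by omega) fun c hc => by omega)) three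
      · exact ht _ _ _ (hs _ _ (edge (b - 2) b (by omega) fun c hc => by omega))
          (ih (b - 2) (by omega) (by omega) (by omega) (by omega))
  intro b hb
  rcases (by omega : b = 0 ∨ b = 1 ∨ b = 2 ∨ b = 3 ∨ (5 ≤ b ∧ b % 2 = 1) ∨ (4 ≤ b ∧ b % 2 = 0))
    with rfl | rfl | rfl | rfl | h | h
  exacts [zero, one, hs _ _ two, three, odd b hb h.1 h.2, even b hb h.1 h.2]

/-- The last two shifts cancel here, so the rearranged matching is itself the lap. From `0` it jumps
to `m - 2` and then descends in blocks 4j, 4j + 1, 4j - 1, 4j - 2, 4j - 4, until 4, 5, 3, 1, 2, 0.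
-/
theorem linked_lap_one {m : ℕ} (hm : m % 4 = 2) (hm' : 2 < m) : Linked m (lap m 1) := by
  intro E hs ht hE
  have edge : ∀ b d, b < m → (∀ c, (b = 0 ∧ c = m - 2) ∨ (b = 1 ∧ c = 2) ∨ (b = 2 ∧ c = 0) ∨
      (b = 3 ∧ c = 1) ∨ (4 ≤ b ∧ b % 4 = 0 ∧ c = b + 1) ∨
      (4 ≤ b ∧ (b % 4 = 1 ∨ b % 4 = 2) ∧ c = b - 2) ∨ (4 ≤ b ∧ b % 4 = 3 ∧ c = b - 1) →
      c = d) → E b d := by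
    intro b d hb hd
    rw [← hd _ ?_]
    · exact hE b hb
    obtain ⟨x, e, hx⟩ := firstShift_row_one hm hm' hb
    have hlt : x < m := by omega
    rw [lap, e, second_third (by omega) hlt (by omega), swapShift, if_pos (by omega), addMod,
      Nat.sub_self, add_zero, if_pos hlt]
    exact hx
  have zero : E 0 0 := ht _ _ _ (hE 0 (by omega)) (hs _ _ (hE 0 (by omega)))
  intro b
  induction b using Nat.strong_induction_on with
  | _ b ih =>
    intro hb
    have next : ∀ c < b, E b c → E b 0 := fun c hc he => ht _ _ _ he (ih c hc (by omega))
    have two : E 2 0 := edge 2 0 (by omega) fun c hc => by omega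
    rcases (by omega : b = 0 ∨ b = 1 ∨ b = 2 ∨ b = 3 ∨ (4 ≤ b ∧ b % 4 = 0) ∨
      (4 ≤ b ∧ b % 4 = 3) ∨ (4 ≤ b ∧ (b % 4 = 1 ∨ b % 4 = 2))) with
      rfl | rfl | rfl | rfl | h | h | h
    · exact zero
    · exact ht _ _ _ (edge 1 2 (by omega) fun c hc => by omega) two
    · exact two
    · exact next 1 (by omega) (edge 3 1 (by omega) fun c hc => by omega)
    · exact next (b - 1) (by omega) (ht _ (b + 1) _ (edge _ _ (by omega) fun c hc => by omega)
        (edge _ _ (by omega) fun c hc => by omega))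
    · exact next (b - 1) (by omega) (edge _ _ (by omega) fun c hc => by omega)
    · exact next (b - 2) (by omega) (edge _ _ (by omega) fun c hc => by omega)

/-- With h = m/2 the last two shifts add h + 1. The cycle is 0, h + 2, 4, h + 4, 6, …, h + 1, 1, h,
2, h + 3, 3, h + 5, 5, …, h - 2, 0. In its two long stretches, two laps raise the number by 2. For h
= 3 it closes directly after 2. -/
theorem linked_lap_zero {m : ℕ} (hm : m % 4 = 2) (hm' : 2 < m) : Linked m (lap m 0) := by
  intro E hs ht hE
  obtain ⟨h, rfl, hodd, h3⟩ : ∃ h, m = 2 * h ∧ h % 2 = 1 ∧ 3 ≤ h := ⟨m / 2, by omega, by omega,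
    by omega⟩
  have edge : ∀ b d, b < 2 * h → (∀ c x, (b = 0 ∧ x = 1) ∨ (b = 1 ∧ x = 2 * h - 1) ∨
      (b = 2 ∧ x = 2) ∨ (b = 3 ∧ x = 4) ∨ (4 ≤ b ∧ b % 2 = 0 ∧ x = b - 1) ∨
      (4 ≤ b ∧ b % 2 = 1 ∧ (b + 1 < 2 * h ∧ x = b + 1 ∨ b + 1 = 2 * h ∧ x = 0)) →
      (x + (h + 1) < 2 * h ∧ c = x + (h + 1)) ∨ (2 * h ≤ x + (h + 1) ∧ c = x + (h + 1) - 2 * h) →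
      c = d) → E b d := by
    intro b d hb hd
    obtain ⟨x, e, hx⟩ := firstShift_row_zero hm hm' hb
    rw [← hd _ x hx ?_]
    · exact hE b hb
    rw [lap, e, second_third_zero (by omega) (by omega), Nat.mul_div_cancel_left h two_pos]
    exact addMod_spec _ _ _
  have next : ∀ b d, b < 2 * h → E b d → E b 0 → E d 0 := fun b d _ hbd hb0 =>
    ht _ _ _ (hs _ _ hbd) hb0
  have zero : E 0 0 := ht _ _ _ (hE 0 (by omega)) (hs _ _ (hE 0 (by omega)))
  have hTwo : E (h + 2) 0 :=
    next 0 _ (by omega) (edge _ _ (by omega) fun c x hx hc => by omega) zero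
  have evenLow : ∀ b, 4 ≤ b → b ≤ h + 1 → b % 2 = 0 → E b 0 := by
    intro b
    induction b using Nat.strong_induction_on with
    | _ b ih =>
      intro h4 hb h0
      rcases (by omega : b = 4 ∨ 6 ≤ b) with rfl | h6
      · exact next (h + 2) _ (by omega) (edge _ _ (by omega) fun c x hx hc => by omega) hTwo
      · exact next (b - 2 + h) _ (by omega) (edge _ _ (by omega) fun c x hx hc => by omega)
          (next (b - 2) _ (by omega) (edge _ _ (by omega) fun c x hx hc => by omega)
            (ih (b - 2) (by omega) (by omega) (by omega) (by omega)))
  have oddHigh : ∀ b, h + 4 ≤ b → b < 2 * h → b % 2 = 1 → E b 0 := fun b hb hb' h1 =>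
    next (b - h) _ (by omega) (edge _ _ (by omega) fun c x hx hc => by omega)
      (evenLow (b - h) (by omega) (by omega) (by omega))
  have one : E 1 0 :=
    next (h + 1) _ (by omega) (edge _ _ (by omega) fun c x hx hc => by omega)
      (evenLow (h + 1) (by omega) le_rfl (by omega))
  have mid : E h 0 :=
    next 1 _ (by omega) (edge _ _ (by omega) fun c x hx hc => by omega) one
  have two : E 2 0 :=
    next h _ (by omega) (edge _ _ (by omega) fun c x hx hc => by omega) mid
  have hThree (_ : 5 ≤ h) : E (h + 3) 0 :=
    next 2 _ (by omega) (edge _ _ (by omega) fun c x hx hc => by omega) two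
  have three (h5 : 5 ≤ h) : E 3 0 :=
    next (h + 3) _ (by omega) (edge _ _ (by omega) fun c x hx hc => by omega) (hThree h5)
  have oddLow : ∀ b, 3 ≤ b → b + 2 ≤ h → b % 2 = 1 → E b 0 := by
    intro b
    induction b using Nat.strong_induction_on with
    | _ b ih =>
      intro hb hb' h1
      rcases (by omega : b = 3 ∨ 5 ≤ b) with rfl | h5
      · exact three (by omega)
      · exact next (b - 2 + h + 2) _ (by omega) (edge _ _ (by omega) fun c x hx hc => by omega)
          (next (b - 2) _ (by omega) (edge _ _ (by omega) fun c x hx hc => by omega)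
            (ih (b - 2) (by omega) (by omega) (by omega) (by omega)))
  have evenHigh : ∀ b, h + 5 ≤ b → b < 2 * h → b % 2 = 0 → E b 0 := fun b hb hb' h0 =>
    next (b - h - 2) _ (by omega) (edge _ _ (by omega) fun c x hx hc => by omega)
      (oddLow (b - h - 2) (by omega) (by omega) (by omega))
  intro b hb
  rcases (by omega : b = 0 ∨ b = 1 ∨ b = 2 ∨ b = h ∨ b = h + 2 ∨ b = h + 3 ∨
    (4 ≤ b ∧ b ≤ h + 1 ∧ b % 2 = 0) ∨ (h + 4 ≤ b ∧ b % 2 = 1) ∨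
    (3 ≤ b ∧ b + 2 ≤ h ∧ b % 2 = 1) ∨ (h + 5 ≤ b ∧ b % 2 = 0)) with
    rfl | rfl | rfl | rfl | rfl | rfl | hc | hc | hc | hc
  exacts [zero, one, two, mid, hTwo, hThree (by omega), evenLow b hc.1 hc.2.1 hc.2.2,
    oddHigh b hc.1 hb hc.2, oddLow b hc.1 hc.2.1 hc.2.2, evenHigh b hc.1 hb hc.2]

theorem linked_lap {m k : ℕ} (hk : k < m) (h : m ≠ 2 ∨ k ≠ 0) : Linked m (lap m k) := by
  by_cases hm : (m % 4 = 2 ∧ 2 < m) ∧ (k + 2 = m ∨ k + 1 = m ∨ k = 0 ∨ k = 1)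
  · obtain ⟨⟨hm, hm'⟩, hk'⟩ := hm
    rcases (by omega : k = m - 2 ∨ k = m - 1 ∨ k = 0 ∨ k = 1) with rfl | rfl | rfl | rfl
    exacts [linked_lap_neg_two hm hm', linked_lap_neg_one hm hm', linked_lap_zero hm hm',
      linked_lap_one hm hm']
  by_cases hk0 : k ≠ 0 ∨ m % 2 = 1
  · refine (linked_succ m).congr fun b hb => ?_
    rw [lap, firstShift_of_not b hm, second_third hk (addMod_lt hb hk.le) hk0]
    unfold swapShift addMod; split_ifs <;> omega
  -- The remaining case is `k = 0` with `m` even; the exclusions of `m = 2` and of the rearranged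
  -- rows leave `m` divisible by 4.
  · refine (linked_half (m := m) (by omega)).congr fun b hb => ?_
    obtain rfl : k = 0 := by omega
    rw [lap, firstShift_of_not b hm, second_third_zero (by omega) (addMod_lt hb hk.le)]
    congr 1
    simp only [addMod, add_zero, if_pos hb]

theorem linked_swap {m k : ℕ} (hk : k < m) :
    Linked m fun b => addMod m (addMod m b k) (swapShift m k) := by
  refine (linked_succ m).congr fun b hb => ?_
  unfold swapShift addMod; split_ifs <;> omega

/-! ### The packing -/

section Packing

variable {V : Type u} {W : Type v}

/-- The arc `uv` lies on a directed `2`-cycle, and `w = u`, or else `u`, `v`, `w` form a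
directed `3`-cycle. -/
def IsShortCycle (G : Digraph V) (u v w : V) : Prop :=
  G.Adj u v ∧ (w = u ∧ G.Adj v u ∨ ¬ G.Adj v u ∧ G.Adj v w ∧ G.Adj w u)

theorem exists_isShortCycle [Fintype V] {G : Digraph V} (hl : Loopless G)
    (hV : 2 ≤ Fintype.card V) (hs : IsStrong G) (h : IsSymmetric G ∨ IsSemicomplete G) :
    ∃ u v w, IsShortCycle G u v w := by
  obtain ⟨x, y, hxy⟩ := Fintype.exists_pair_of_one_lt_card hV
  obtain ⟨v, hv⟩ : ∃ v, G.Adj x v := by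
    rcases Relation.ReflTransGen.cases_head (hs x y) with h | ⟨v, hv, -⟩
    exacts [(hxy h).elim, ⟨v, hv⟩]
  by_cases h2 : ∃ u v, G.Adj u v ∧ G.Adj v u
  · obtain ⟨u, v, huv, hvu⟩ := h2
    exact ⟨u, v, u, huv, .inl ⟨rfl, hvu⟩⟩
  have hsc : IsSemicomplete G := h.resolve_left fun hsy => h2 ⟨x, v, hv, hsy _ _ hv⟩
  -- Otherwise some arc leads from the out-neighbourhood of `x` to its in-neighbourhood.
  have key : ∀ z, Relation.ReflTransGen G.Adj v z →
      G.Adj x z ∨ ∃ a b, G.Adj x a ∧ G.Adj a b ∧ G.Adj b x := by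
    intro z hz
    induction hz with
    | refl => exact .inl hv
    | @tail b c _ hbc ih =>
      rcases ih with ih | ih
      · by_cases hc : c = x
        · subst hc; exact (h2 ⟨_, _, ih, hbc⟩).elim
        · rcases hsc c x hc with hcx | hxc
          · exact .inr ⟨b, c, ih, hbc, hcx⟩
          · exact .inl hxc
      · exact .inr ih
  rcases key x (hs v x) with h | ⟨a, b, hxa, hab, hbx⟩
  · exact (hl x h).elim
  · exact ⟨x, a, b, hxa, .inr ⟨fun h => h2 ⟨_, _, hxa, h⟩, hab, hbx⟩⟩

theorem Admissible.exists_isShortCycle [Fintype V] {G : Digraph V} {H : Digraph W} (hA : Admissible G H) :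
    ∃ u v w, IsShortCycle G u v w :=
  StrongPacking.exists_isShortCycle hA.loopless_left hA.two_le_card
    (hA.cond.elim And.left And.left) (hA.cond.imp And.right fun h => h.2.1)

/-- The shift along the arc from `a` to `c` in the `k`-th subgraph. -/
def arcShift {V : Type*} [DecidableEq V] (m h m₄ : ℕ) (u v w a c : V) (k b b₄ : ℕ) : ℕ :=
  if a = u then if c = v then if w = u then k else firstShift m m₄ k b b₄ else k
  else if a = v then
    if w = u then if c = u then swapShift m k else k
    else if c = w then secondShift m h k else k
  else if a = w then if c = u then thirdShift m h k else k
  else k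

/-- The shift only compares vertices for equality, so it may be computed with their numbers, as the
program does. -/
theorem arcShift_map {V : Type*} {V' : Type*} [DecidableEq V] [DecidableEq V'] {f : V → V'}
    (hf : Function.Injective f) (m h m₄ : ℕ) (u v w a c : V) (k b b₄ : ℕ) :
    arcShift m h m₄ (f u) (f v) (f w) (f a) (f c) k b b₄ =
      arcShift m h m₄ u v w a c k b b₄ := by
  simp only [arcShift, hf.eq_iff]

section

variable [DecidableEq V] {m : ℕ} (u v w a c : V)

theorem arcShift_le {k : ℕ} (b : ℕ) (hk : k < m) :
    arcShift m (m / 2) (m % 4) u v w a c k b (b % 4) ≤ m := by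
  unfold arcShift
  split_ifs
  exacts [hk.le, (firstShift_lt b hk).le, hk.le, swapShift_le hk, hk.le, (secondShift_lt hk).le,
    hk.le, thirdShift_le hk, hk.le, hk.le]

theorem addMod_arcShift_inj {k k' b : ℕ} (hk : k < m) (hk' : k' < m) (hb : b < m)
    (h : addMod m b (arcShift m (m / 2) (m % 4) u v w a c k b (b % 4)) =
      addMod m b (arcShift m (m / 2) (m % 4) u v w a c k' b (b % 4))) : k = k' := by
  have triv (h : addMod m b k = addMod m b k') : k = k' := by
    have := addMod_right hk.le hk'.le h; omega
  unfold arcShift at h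
  split_ifs at h
  exacts [triv h, addMod_firstShift_inj hk hk' h, triv h, addMod_swapShift_inj hk hk' hb h,
    triv h, addMod_secondShift_inj hk hk' h, triv h, addMod_thirdShift_inj hk hk' h, triv h, triv h]

theorem addMod_arcShift_left_inj {k b b' : ℕ} (hb : b < m) (hb' : b' < m)
    (h : addMod m b (arcShift m (m / 2) (m % 4) u v w a c k b (b % 4)) =
      addMod m b' (arcShift m (m / 2) (m % 4) u v w a c k b' (b' % 4))) : b = b' := by
  unfold arcShift at h
  split_ifs at h
  all_goals first
    | exact addMod_firstShift_left_inj hb hb' h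
    | exact addMod_left_inj hb hb' h

end

variable [DecidableEq V] (G : Digraph V) (H : Digraph W) {m : ℕ} (e : W ≃ Fin m)

/-- The `k`-th subgraph contains for each arc `ac` of `G` the arcs of a perfect matching from the
copy of `H` at `a` to the one at `c`; the subgraph with index `0` contains also the arcs of the
copies of `H`. -/
def packing (u v w : V) (k : Fin m) : Subdigraph (lexProduct G H) where
  verts := Set.univ
  Adj p q := (G.Adj p.1 q.1 ∧ (e q.2 : ℕ) = addMod m (e p.2)
      (arcShift m (m / 2) (m % 4) u v w p.1 q.1 k (e p.2) ((e p.2 : ℕ) % 4))) ∨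
    ((k : ℕ) = 0 ∧ p.1 = q.1 ∧ H.Adj p.2 q.2)
  adj_sub := fun h => h.imp And.left And.right
  fst_mem := fun _ => trivial
  snd_mem := fun _ => trivial

variable {G H} {u v w : V} {k : Fin m}

theorem packing_arcDisjoint (hG : Loopless G) {k l : Fin m} (hkl : k ≠ l) :
    (packing G H e u v w k).ArcDisjoint (packing G H e u v w l) := by
  rintro ⟨a, b⟩ ⟨c, d⟩ ⟨⟨h, hk⟩ | ⟨hk, h, -⟩, ⟨h', hl⟩ | ⟨hl, h', -⟩⟩
  · exact hkl (Fin.ext (addMod_arcShift_inj u v w a c k.2 l.2 (e b).2 (hk.symm.trans hl)))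
  · simp only at h h'
    exact hG a (by rwa [← h'] at h)
  · simp only at h h'
    exact hG a (by rwa [← h] at h')
  · exact hkl (Fin.ext (hk.trans hl.symm))

theorem exists_packing_adj_right {a c : V} (h : G.Adj a c) (b : W) :
    ∃ d, (packing G H e u v w k).Adj (a, b) (c, d) ∧
      (e d : ℕ) = addMod m (e b)
        (arcShift m (m / 2) (m % 4) u v w a c k (e b) ((e b : ℕ) % 4)) := by
  refine ⟨e.symm ⟨_, addMod_lt (e b).2 (arcShift_le u v w a c (e b) k.2)⟩, ?_, ?_⟩
  · left; simp [h]
  · simp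

theorem exists_packing_adj_left {a c : V} (h : G.Adj a c) (d : W) :
    ∃ b, (packing G H e u v w k).Adj (a, b) (c, d) := by
  let f : Fin m → Fin m := fun b =>
    ⟨_, addMod_lt b.2 (arcShift_le u v w a c b k.2)⟩
  have hf : Function.Injective f := fun b b' hb =>
    Fin.ext (addMod_arcShift_left_inj u v w a c b.2 b'.2 (Fin.ext_iff.1 hb))
  obtain ⟨b, hb⟩ := Finite.surjective_of_injective hf (e d)
  refine ⟨e.symm b, .inl ⟨h, ?_⟩⟩
  simp [← hb, f]

/-- A path of G can be lifted from any prescribed initial vertex, and also to any prescribed final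
vertex because the matchings are perfect. Hence every vertex reaches the fibre over `u` and is
reached from it. -/
theorem packing_isStrong_of_fibre (hG : IsStrong G)
    (h : ∀ b d, Relation.ReflTransGen (packing G H e u v w k).Adj (u, b) (u, d)) :
    (packing G H e u v w k).IsStrong := by
  have fwd : ∀ {a c}, Relation.ReflTransGen G.Adj a c → ∀ b,
      ∃ d, Relation.ReflTransGen (packing G H e u v w k).Adj (a, b) (c, d) := by
    intro a c hac b
    induction hac with
    | refl => exact ⟨b, .refl⟩
    | tail _ hcc ih =>
      obtain ⟨d, hd⟩ := ih
      obtain ⟨d', hd', -⟩ := exists_packing_adj_right e hcc d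
      exact ⟨d', hd.tail hd'⟩
  have bwd : ∀ {a c}, Relation.ReflTransGen G.Adj a c → ∀ d,
      ∃ b, Relation.ReflTransGen (packing G H e u v w k).Adj (a, b) (c, d) := by
    intro a c hac
    induction hac with
    | refl => exact fun d => ⟨d, .refl⟩
    | tail _ hcc ih =>
      intro d
      obtain ⟨d', hd'⟩ := exists_packing_adj_left e hcc d
      obtain ⟨b, hb⟩ := ih d'
      exact ⟨b, hb.tail hd'⟩
  rintro ⟨a, b⟩ - ⟨c, d⟩ -
  obtain ⟨b', hb'⟩ := fwd (hG a u) b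
  obtain ⟨d', hd'⟩ := bwd (hG u c) d
  exact (hb'.trans (h b' d')).trans hd'

/-- A preorder on `Fin m` that contains the graph of a permutation with a single orbit is total. -/
theorem Linked.rel {f : ℕ → ℕ} (hf : Linked m f) (hlt : ∀ b < m, f b < m)
    (hinj : ∀ b < m, ∀ b' < m, f b = f b' → b = b') {R : Fin m → Fin m → Prop}
    (refl : ∀ x, R x x) (trans : ∀ x y z, R x y → R y z → R x z)
    (h : ∀ b : Fin m, R b ⟨f b, hlt b b.2⟩) (x y : Fin m) : R x y := by
  let g : Fin m → Fin m := fun b => ⟨f b, hlt b b.2⟩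
  have hg : Function.Injective g := fun b b' hb =>
    Fin.ext (hinj b b.2 b' b'.2 (Fin.ext_iff.1 hb))
  let σ : Equiv.Perm (Fin m) := Equiv.ofBijective g (Finite.injective_iff_bijective.1 hg)
  have pow : ∀ n x, R x ((σ ^ n) x) := by
    intro n
    induction n with
    | zero => exact fun x => refl x
    | succ n ih =>
      intro x
      rw [pow_succ']
      exact trans _ _ _ (ih x) (h _)
  -- A permutation of a finite set is inverted by one of its powers, so forward steps also lead
  -- back. This is why orbits may be treated as undirected above.
  have back : ∀ x, R (g x) x := by
    intro x
    have := pow (orderOf σ - 1) (σ x)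
    rwa [← Equiv.Perm.mul_apply, ← pow_succ, Nat.sub_add_cancel (orderOf_pos σ),
      pow_orderOf_eq_one] at this
  let E : ℕ → ℕ → Prop := fun i j =>
    ∃ (hi : i < m) (hj : j < m), R ⟨i, hi⟩ ⟨j, hj⟩ ∧ R ⟨j, hj⟩ ⟨i, hi⟩
  have hE := hf E (fun i j ⟨hi, hj, h₁, h₂⟩ => ⟨hj, hi, h₂, h₁⟩)
    (fun i j l ⟨hi, hj, h₁, h₂⟩ ⟨_, hl, h₃, h₄⟩ =>
      ⟨hi, hl, trans _ _ _ h₁ h₃, trans _ _ _ h₄ h₂⟩)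
    fun b hb => ⟨hb, hlt b hb, h ⟨b, hb⟩, back ⟨b, hb⟩⟩
  obtain ⟨_, h0, hx, _⟩ := hE x x.2
  obtain ⟨_, _, _, hy⟩ := hE y y.2
  exact trans _ _ _ hx hy

theorem fibre_of_linked {V : Type*} {W : Type*} {u : V} (e : W ≃ Fin m) {f : ℕ → ℕ}
    (hf : Linked m f) (hlt : ∀ b < m, f b < m)
    (hinj : ∀ b < m, ∀ b' < m, f b = f b' → b = b') {R : V × W → V × W → Prop}
    (h : ∀ b d : W, (e d : ℕ) = f (e b) → Relation.ReflTransGen R (u, b) (u, d)) (b d : W) :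
    Relation.ReflTransGen R (u, b) (u, d) := by
  have := hf.rel hlt hinj
    (R := fun x y => Relation.ReflTransGen R (u, e.symm x) (u, e.symm y)) (fun _ => .refl)
    (fun _ _ _ => .trans) (fun b => h _ _ (by simp)) (e b) (e d)
  simpa using this

theorem packing_isStrong_of_two_cycle (hG : IsStrong G) (hl : Loopless G) (huv : G.Adj u v)
    (hvu : G.Adj v u) : (packing G H e u v u k).IsStrong := by
  have hne : v ≠ u := by rintro rfl; exact hl _ huv
  refine packing_isStrong_of_fibre e hG (fibre_of_linked e (linked_swap k.2)
    (fun b hb => addMod_lt (addMod_lt hb k.2.le) (swapShift_le k.2)) ?_ ?_)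
  · intro b hb b' hb' h
    exact addMod_left_inj hb hb'
      (addMod_left_inj (addMod_lt hb k.2.le) (addMod_lt hb' k.2.le) h)
  · intro b d hd
    obtain ⟨b₁, h₁, e₁⟩ := exists_packing_adj_right (u := u) (v := v) (w := u) (k := k) (H := H)
      e huv b
    obtain ⟨b₂, h₂, e₂⟩ := exists_packing_adj_right (u := u) (v := v) (w := u) (k := k) (H := H)
      e hvu b₁
    simp only [arcShift, if_true, if_neg hne] at e₁ e₂
    obtain rfl : d = b₂ := e.injective (Fin.ext (by rw [hd, e₂, e₁]))
    exact .tail (.single h₁) h₂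

theorem packing_isStrong_of_three_cycle (hG : IsStrong G) (hl : Loopless G) (huv : G.Adj u v)
    (hvw : G.Adj v w) (hwu : G.Adj w u) (hH : m = 2 → ∃ x y, x ≠ y ∧ H.Adj x y) :
    (packing G H e u v w k).IsStrong := by
  have hne : v ≠ u := by rintro rfl; exact hl _ huv
  have hwv : w ≠ v := by rintro rfl; exact hl _ hvw
  have hwu' : w ≠ u := by rintro rfl; exact hl _ hwu
  apply packing_isStrong_of_fibre e hG
  have step (b : W) : ∃ b₁ b₂ b₃, (packing G H e u v w k).Adj (u, b) (v, b₁) ∧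
      (packing G H e u v w k).Adj (v, b₁) (w, b₂) ∧ (packing G H e u v w k).Adj (w, b₂) (u, b₃) ∧
      (e b₁ : ℕ) = addMod m (e b) (firstShift m (m % 4) k (e b) ((e b : ℕ) % 4)) ∧
      (e b₂ : ℕ) = addMod m (e b₁) (secondShift m (m / 2) k) ∧
      (e b₃ : ℕ) = addMod m (e b₂) (thirdShift m (m / 2) k) := by
    obtain ⟨b₁, h₁, e₁⟩ := exists_packing_adj_right (u := u) (v := v) (w := w) (k := k) (H := H)
      e huv b
    obtain ⟨b₂, h₂, e₂⟩ := exists_packing_adj_right (u := u) (v := v) (w := w) (k := k) (H := H)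
      e hvw b₁
    obtain ⟨b₃, h₃, e₃⟩ := exists_packing_adj_right (u := u) (v := v) (w := w) (k := k) (H := H)
      e hwu b₂
    simp only [arcShift, if_true, if_neg hne, if_neg hwv, if_neg hwu'] at e₁ e₂ e₃
    exact ⟨b₁, b₂, b₃, h₁, h₂, h₃, e₁, e₂, e₃⟩
  by_cases h2 : m ≠ 2 ∨ (k : ℕ) ≠ 0
  · have lt₁ : ∀ b < m, addMod m b (firstShift m (m % 4) k b (b % 4)) < m := fun b hb =>
      addMod_lt hb (firstShift_lt b k.2).le
    have lt₂ : ∀ b < m, addMod m (addMod m b (firstShift m (m % 4) k b (b % 4)))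
        (secondShift m (m / 2) k) < m := fun b hb => addMod_lt (lt₁ b hb) (secondShift_lt k.2).le
    refine fibre_of_linked e (linked_lap k.2 h2)
      (fun b hb => addMod_lt (lt₂ b hb) (thirdShift_le k.2)) ?_ ?_
    · intro b hb b' hb' h
      exact addMod_firstShift_left_inj hb hb' (addMod_left_inj (lt₁ b hb) (lt₁ b' hb')
        (addMod_left_inj (lt₂ b hb) (lt₂ b' hb') h))
    · intro b d hd
      obtain ⟨b₁, b₂, b₃, h₁, h₂, h₃, e₁, e₂, e₃⟩ := step b
      obtain rfl : d = b₃ := e.injective (Fin.ext (by rw [hd, e₃, e₂, e₁, lap]))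
      exact .tail (.tail (.single h₁) h₂) h₃
  · -- Here the lap is trivial, and arcs of two copies of `H` are needed.
    push Not at h2
    obtain ⟨rfl, hk⟩ := h2
    obtain ⟨x, y, hxy, hH⟩ := hH rfl
    have hxy' : (e x : ℕ) ≠ e y := fun h => hxy (e.injective (Fin.ext h))
    have eq_or (z : W) : z = x ∨ z = y := by
      have : (e z : ℕ) = e x ∨ (e z : ℕ) = e y := by omega
      exact this.imp (fun h => e.injective (Fin.ext h)) fun h => e.injective (Fin.ext h)
    have fibre (a : V) : (packing G H e u v w k).Adj (a, x) (a, y) := .inr ⟨hk, rfl, hH⟩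
    obtain ⟨y₁, y₂, y₃, h₁, h₂, -, e₁, e₂, -⟩ := step y
    obtain ⟨x₁, x₂, x₃, -, -, h₃, e₁', e₂', e₃'⟩ := step x
    simp only [hk] at e₁ e₂ e₁' e₂' e₃'
    norm_num [firstShift, secondShift, thirdShift, addMod] at e₁ e₂ e₁' e₂' e₃'
    obtain rfl : y₂ = x := e.injective (Fin.ext (by split_ifs at * <;> omega))
    obtain rfl : x₂ = y := e.injective (Fin.ext (by split_ifs at * <;> omega))
    obtain rfl : x₃ = y₂ := e.injective (Fin.ext (by split_ifs at * <;> omega))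
    -- In the original names the walk is (u, y), (v, y), (w, x), (w, y), (u, x), with an arc of H in
    -- the fibre over `w`.
    have yx : Relation.ReflTransGen (packing G H e u v w k).Adj (u, x₂) (u, x₃) :=
      .tail (.tail (.tail (.single h₁) h₂) (fibre w)) h₃
    intro b d
    rcases eq_or b with rfl | rfl <;> rcases eq_or d with rfl | rfl
    exacts [.refl, .single (fibre u), yx, .refl]

theorem packing_isSStrongPacking [Fintype V] (hA : Admissible G H) (hc : IsShortCycle G u v w)
    (S : Finset (V × W)) : IsSStrongPacking S (packing G H e u v w) := by
  refine ⟨fun k => ⟨?_, fun _ _ => trivial⟩, fun k l => packing_arcDisjoint e hA.loopless_left⟩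
  have hs : IsStrong G := hA.cond.elim And.left And.left
  obtain ⟨huv, ⟨rfl, hvu⟩ | ⟨hvu, hvw, hwu⟩⟩ := hc
  · exact packing_isStrong_of_two_cycle e hs hA.loopless_left huv hvu
  · refine packing_isStrong_of_three_cycle e hs hA.loopless_left huv hvw hwu ?_
    -- In this branch `vu` is not an arc, so `G` is not symmetric; the second alternative must hold,
    -- and it provides an arc of `H`. The clause `¬ G.Adj v u` in `IsShortCycle` serves this
    -- purpose.
    rintro rfl
    rcases hA.cond with ⟨-, h⟩ | ⟨-, -, h⟩
    · exact (hvu (h _ _ huv)).elim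
    · by_contra! hno
      refine h ⟨e, ?_⟩
      intro x y
      have hxy : ¬ H.Adj x y := by
        by_cases hxy : x = y
        · exact hxy ▸ hA.loopless_right x
        · exact hno x y hxy
      simp [hxy]

end Packing

/-! ### The program -/

theorem Mem.Agrees.update {a : Mem} {ρ : Fin 20 → ℕ} {M : Finset (Fin 20)} {x : Fin 20} {v : ℕ}
    (h : a.Agrees ρ (insert x M)) (hv : a.env x = v) : a.Agrees (Function.update ρ x v) M := by
  have : a.set x v = a := Mem.ext' (by simp [Mem.set, ← hv]) rfl
  exact this ▸ h.set v

theorem Mem.Agrees.set_mem {a : Mem} {ρ : Fin 20 → ℕ} {M : Finset (Fin 20)} {x : Fin 20}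
    (h : a.Agrees ρ M) (hx : x ∈ M) (v : ℕ) : (a.set x v).Agrees ρ M := by
  intro z hz
  have : z ≠ x := by rintro rfl; exact hz hx
  simp [Mem.set, Function.update_of_ne this, h z hz]

/-- Reduce a copy of register `y` modulo `4`; register `14` has to contain `3`. -/
def modFour (x y : Fin 20) : Prog :=
  .seq (assign x (.var y)) (.while (.lt 14 x) (assign x (.sub (.var x) (.lit 4))))

theorem Hoare.modFour {Φ : Mem → Prop} {M : Finset (Fin 20)} {ρ : Fin 20 → ℕ} {x y : Fin 20}
    {N : ℕ} (hy : y ∉ insert x M) (hx : (14 : Fin 20) ∉ insert x M) (h14 : ρ 14 = 3)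
    (hΦ : ∀ a v, Φ a → Φ (a.set x v)) (hN : ρ y ≤ N) :
    Hoare (fun a => a.Agrees ρ (insert x M) ∧ Φ a) (modFour x y)
      (fun a => a.Agrees (Function.update ρ x (ρ y % 4)) M ∧ Φ a) (2 + (N + 1) * 5) := by
  refine (Hoare.seq (Hoare.assign x (.var y) _) (Hoare.while
    (P := fun a => (a.Agrees ρ (insert x M) ∧ Φ a) ∧ a.env x % 4 = ρ y % 4) (T := 4) 14 x
    (fun a => a.env x) ?_ N)).consequence ?_ ?_ le_rfl
  · intro N'
    refine (Hoare.assign x (.sub (.var x) (.lit 4)) _).consequence ?_ (fun _ h => h) le_rfl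
    rintro a ⟨⟨⟨ha, hs⟩, h4⟩, hlt, rfl⟩
    rw [ha 14 hx, h14] at hlt
    refine ⟨⟨⟨ha.set_mem (Finset.mem_insert_self _ _) _, hΦ _ _ hs⟩, ?_⟩, ?_⟩ <;>
    · simp only [Arith.eval, Mem.set, Function.update_self]
      omega
  · rintro a ⟨ha, hs⟩
    have := ha y hy
    refine ⟨⟨⟨ha.set_mem (Finset.mem_insert_self _ _) _, hΦ _ _ hs⟩, ?_⟩, ?_⟩ <;>
      simp [Arith.eval, Mem.set, this, hN]
  · rintro a ⟨⟨⟨ha, hs⟩, h4⟩, hlt⟩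
    rw [ha 14 hx, h14] at hlt
    exact ⟨ha.update (by omega), hs⟩

/-- Put the integral part of half of register `1` into register `2`; register `13` has to
contain `1`. -/
def halve : Prog :=
  .seq (assign 2 (.lit 0)) (.seq (assign 15 (.var 1)) (.while (.lt 13 15)
    (.seq (assign 15 (.sub (.var 15) (.lit 2))) (assign 2 (.add (.var 2) (.lit 1))))))

theorem Hoare.halve {n m N : ℕ} {A : ℕ → List ℕ → ℕ} (hN : m ≤ N) :
    Hoare (fun a => a.env 0 = n ∧ a.env 1 = m ∧ a.env 13 = 1 ∧ a.env 14 = 3 ∧ a.arr = A) halve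
      (fun a => a.env 0 = n ∧ a.env 1 = m ∧ a.env 2 = m / 2 ∧ a.env 13 = 1 ∧ a.env 14 = 3 ∧
        a.arr = A) (2 + (2 + (N + 1) * 9)) := by
  refine (Hoare.seq (Hoare.assign 2 (.lit 0) _) (Hoare.seq (Hoare.assign 15 (.var 1) _)
    (Hoare.while (P := fun a => a.env 0 = n ∧ a.env 1 = m ∧ 2 * a.env 2 + a.env 15 = m ∧
      a.env 13 = 1 ∧ a.env 14 = 3 ∧ a.arr = A) (T := 4 + 4) 13 15
      (fun a => a.env 15) ?_ N))).consequence ?_ ?_ le_rfl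
  · intro N'
    refine (Hoare.seq (Hoare.assign 15 (.sub (.var 15) (.lit 2)) _)
      (Hoare.assign 2 (.add (.var 2) (.lit 1)) _)).consequence ?_ (fun _ h => h) le_rfl
    rintro a ⟨⟨h0, h1, h2, h13, h14, hA⟩, hlt, rfl⟩
    rw [h13] at hlt
    simp only [Arith.eval, Mem.set, Function.update_apply, Fin.reduceEq, if_true, if_false]
    refine ⟨⟨h0, h1, ?_, h13, h14, hA⟩, ?_⟩ <;> omega
  · rintro a ⟨h0, h1, h13, h14, hA⟩
    simp only [Arith.eval, Mem.set, Function.update_apply, Fin.reduceEq, if_true, if_false]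
    refine ⟨⟨h0, h1, ?_, h13, h14, hA⟩, ?_⟩ <;> omega
  · rintro a ⟨⟨h0, h1, h2, h13, h14, hA⟩, hlt⟩
    rw [h13] at hlt
    exact ⟨h0, h1, by omega, h13, h14, hA⟩

/-- The predicate `IsShortCycle` for the digraph with adjacency matrix `A`. -/
def IsShortCycleMatrix (A : List ℕ → ℕ) (u v w : ℕ) : Prop :=
  A [u, v] = 1 ∧ (w = u ∧ A [v, u] = 1 ∨ A [v, u] ≠ 1 ∧ A [v, w] = 1 ∧ A [w, u] = 1)

/-- Test whether registers `8`, `9`, `11` contain a short cycle. -/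
def shortCycleTest : Arith :=
  .ifEq (.load 0 [8, 9]) (.lit 1)
    (.ifEq (.load 0 [9, 8]) (.lit 1) (.ifEq (.var 11) (.var 8) (.lit 1) (.lit 0))
      (.ifEq (.load 0 [9, 11]) (.lit 1)
        (.ifEq (.load 0 [11, 8]) (.lit 1) (.lit 1) (.lit 0)) (.lit 0)))
    (.lit 0)

theorem eval_shortCycleTest (a : Mem) : shortCycleTest.eval a = 1 ↔
    IsShortCycleMatrix (a.arr 0) (a.env 8) (a.env 9) (a.env 11) := by
  simp only [shortCycleTest, Arith.eval, IsShortCycleMatrix, List.map_cons, List.map_nil]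
  split_ifs <;> simp_all

/-- Record the short cycle, if there is one, in registers `4`, `5`, `6`. -/
def searchStep : Prog :=
  .seq (assign 15 shortCycleTest) (.ite (.eq 13 15)
    (.seq (assign 4 (.var 8)) (.seq (assign 5 (.var 9)) (assign 6 (.var 11)))) .skip)

def search : Prog :=
  forLoop 8 0 (forLoop 9 0 (forLoop 11 0 searchStep))

/-- A short cycle has been recorded, or there is none in `R`. -/
def SearchState (A : ℕ → List ℕ → ℕ) (R : Set (ℕ × ℕ × ℕ)) (a : Mem) : Prop :=
  a.arr = A ∧ (IsShortCycleMatrix (A 0) (a.env 4) (a.env 5) (a.env 6) ∨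
    ∀ p ∈ R, ¬ IsShortCycleMatrix (A 0) p.1 p.2.1 p.2.2)

/-- A recorded cycle is only ever overwritten by another short cycle, so success persists through
the search. -/
theorem progress_searchStep {A : ℕ → List ℕ → ℕ} {ρ : Fin 20 → ℕ} (h13 : ρ 13 = 1) :
    Progress (SearchState A) {4, 5, 6, 15} ρ searchStep {(ρ 8, ρ 9, ρ 11)}
      (shortCycleTest.cost + 1 + (2 + (2 + 2) + 1 + 1)) := by
  intro R
  refine Hoare.seq (Q := fun a => (a.Agrees ρ {4, 5, 6, 15} ∧ SearchState A R a) ∧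
    (a.env 15 = 1 ↔ IsShortCycleMatrix (A 0) (ρ 8) (ρ 9) (ρ 11)))
    ((Hoare.assign 15 shortCycleTest _).consequence ?_ (fun _ h => h) le_rfl)
    (Hoare.ite (T := 2 + (2 + 2)) (T' := 1) 13 15 ((Hoare.seq (Hoare.assign 4 (.var 8) _) (Hoare.seq
      (Hoare.assign 5 (.var 9) _) (Hoare.assign 6 (.var 11) _))).consequence ?_ (fun _ h => h)
        le_rfl) ?_)
  · rintro a ⟨ha, hA, hs⟩
    refine ⟨⟨ha.set_mem (by decide) _, hA, ?_⟩, ?_⟩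
    · simpa [Mem.set, Function.update_apply] using hs
    · simp only [Mem.set, Function.update_self, eval_shortCycleTest, hA]
      rw [ha 8 (by decide), ha 9 (by decide), ha 11 (by decide)]
  · rintro a ⟨⟨⟨ha, hA, hs⟩, h15⟩, heq⟩
    rw [ha 13 (by decide), h13, eq_comm, h15, ← ha 8 (by decide), ← ha 9 (by decide),
      ← ha 11 (by decide)] at heq
    refine ⟨((ha.set_mem (by decide) _).set_mem (by decide) _).set_mem (by decide) _, hA,
      .inl ?_⟩
    simpa [Mem.set, Function.update_apply, Arith.eval] using heq
  · rintro s ⟨⟨⟨ha, hA, hs⟩, h15⟩, hne⟩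
    refine ⟨s, 1, .skip s, le_rfl, ha, hA, hs.imp_right fun hs p hp => ?_⟩
    rcases hp with hp | rfl
    · exact hs p hp
    · rw [← h15]
      rw [ha 13 (by decide), h13] at hne
      exact hne.symm

theorem SearchState.set {A : ℕ → List ℕ → ℕ} {x : Fin 20} (h4 : x ≠ 4) (h5 : x ≠ 5)
    (h6 : x ≠ 6) (R : Set (ℕ × ℕ × ℕ)) (a : Mem) (v : ℕ) (h : SearchState A R a) :
    SearchState A R (a.set x v) := by
  simpa [SearchState, Mem.set, Function.update_of_ne, h4.symm, h5.symm, h6.symm] using h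

def searchCost (N : ℕ) : ℕ :=
  N * (N * (N * (shortCycleTest.cost + 1 + (2 + (2 + 2) + 1 + 1) + 5) + 3 + 5) + 3 + 5) + 3

theorem progress_search {A : ℕ → List ℕ → ℕ} {ρ : Fin 20 → ℕ} {N : ℕ} (h13 : ρ 13 = 1)
    (hN : ρ 0 ≤ N) : Progress (SearchState A) {8, 9, 11, 4, 5, 6, 15} ρ search
      {p | ∃ u < ρ 0, ∃ v < ρ 0, ∃ w < ρ 0, p = (u, v, w)} (searchCost N) := by
  refine Progress.forLoop (by decide) (by decide)
    (SearchState.set (by decide) (by decide) (by decide)) hN fun u hu => ?_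
  refine Progress.forLoop (C := fun v => {p | ∃ w < ρ 0, p = (u, v, w)}) (by decide) (by decide)
    (SearchState.set (by decide) (by decide) (by decide)) hN fun v hv => ?_
  refine Progress.forLoop (C := fun w => {(u, v, w)}) (by decide) (by decide)
    (SearchState.set (by decide) (by decide) (by decide)) hN fun w hw => ?_
  exact progress_searchStep h13

/-- Expressions for the definitions of the same names. -/
def addModArith (b s : Arith) : Arith :=
  .ifLt (.add b s) (.var 1) (.add b s) (.sub (.add b s) (.var 1))

def firstShiftArith : Arith :=
  let m : Arith := .var 1
  let k : Arith := .var 7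
  let b : Arith := .var 9
  let b₄ : Arith := .var 10
  .ifEq (.var 3) (.lit 2)
    (.ifLt (.lit 2) m
      (.ifEq (.add k (.lit 2)) m
        (.ifLt b (.lit 3) (.sub m (.lit 1)) (.ifEq b (.lit 3) (.lit 0)
          (.ifEq b₄ (.lit 1) (.sub m (.lit 1)) (.ifEq b₄ (.lit 2) (.lit 1) (.sub m (.lit 2))))))
        (.ifEq (.add k (.lit 1)) m
          (.ifEq b (.lit 2) (.lit 1) (.ifEq b (.lit 3) (.sub m (.lit 1)) (.lit 0)))
          (.ifEq k (.lit 0)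
            (.ifLt b (.lit 4)
              (.ifEq b (.lit 1) (.sub m (.lit 2)) (.ifEq b (.lit 2) (.lit 0) (.lit 1)))
              (.ifEq b₄ (.lit 0) (.sub m (.lit 1))
                (.ifEq b₄ (.lit 2) (.sub m (.lit 1)) (.lit 1))))
            (.ifEq k (.lit 1)
              (.ifLt b (.lit 4) (.ifEq b (.lit 1) (.lit 1) (.sub m (.lit 2)))
                (.ifEq b₄ (.lit 0) (.lit 1)
                  (.ifEq b₄ (.lit 3) (.sub m (.lit 1)) (.sub m (.lit 2)))))
              k))))
      k)
    k

def secondShiftArith : Arith :=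
  .ifEq (.add (.var 2) (.var 2)) (.var 1)
    (.ifEq (.var 7) (.lit 0) (.var 2)
      (.ifLt (.var 7) (.add (.var 2) (.lit 1)) (.sub (.var 7) (.lit 1)) (.var 7)))
    (.var 7)

def thirdShiftArith : Arith :=
  .ifEq (.var 7) (.lit 0) (.lit 1)
    (.ifLt (.var 7) (.add (.var 2) (.lit 1))
      (.sub (.add (.add (.var 2) (.var 2)) (.lit 2)) (.add (.var 7) (.var 7)))
      (.sub (.add (.add (.var 1) (.var 1)) (.lit 1)) (.add (.var 7) (.var 7))))

def swapShiftArith : Arith :=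
  .ifLt (.var 7) (.lit 2) (.sub (.lit 1) (.var 7)) (.sub (.add (.var 1) (.lit 1)) (.var 7))

def arcShiftArith : Arith :=
  let k : Arith := .var 7
  let a : Arith := .var 8
  let c : Arith := .var 11
  let u : Arith := .var 4
  let v : Arith := .var 5
  let w : Arith := .var 6
  .ifEq a u (.ifEq c v (.ifEq w u k firstShiftArith) k)
    (.ifEq a v (.ifEq w u (.ifEq c u swapShiftArith k) (.ifEq c w secondShiftArith k))
      (.ifEq a w (.ifEq c u thirdShiftArith k) k))

theorem eval_addModArith (a : Mem) (b s : Arith) :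
    (addModArith b s).eval a = addMod (a.env 1) (b.eval a) (s.eval a) := rfl

theorem eval_arcShiftArith (a : Mem) : arcShiftArith.eval a =
    arcShift (a.env 1) (a.env 2) (a.env 3) (a.env 4) (a.env 5) (a.env 6) (a.env 8) (a.env 11)
      (a.env 7) (a.env 9) (a.env 10) := rfl

/-- The entry for the arc from `(a, b)` to `(c, d)` in the `k`-th subgraph, where `A` and `B` are
the adjacency matrices of the factors. -/
def arcEntry (A B : List ℕ → ℕ) (m u v w k a b c d : ℕ) : ℕ :=
  if A [a, c] = 1 then
    if d = addMod m b (arcShift m (m / 2) (m % 4) u v w a c k b (b % 4)) then 1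
    else if k = 0 then if a = c then B [b, d] else 0 else 0
  else if k = 0 then if a = c then B [b, d] else 0 else 0

def arcArith : Arith :=
  let fibre : Arith := .ifEq (.var 7) (.lit 0)
    (.ifEq (.var 8) (.var 11) (.load 1 [9, 12]) (.lit 0)) (.lit 0)
  .ifEq (.load 0 [8, 11]) (.lit 1)
    (.ifEq (.var 12) (addModArith (.var 9) arcShiftArith) (.lit 1) fibre) fibre

/-- Register `10` contains the residue of register `9` modulo `4` in the inner loops. -/
def fill : Prog :=
  forLoop 7 1 (forLoop 8 0 (forLoop 9 1 (.seq (modFour 10 9) (.seq (write 3 [7, 8, 9] (.lit 1))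
    (forLoop 11 0 (forLoop 12 1 (write 4 [7, 8, 9, 11, 12] arcArith)))))))

/-- The output: the entries of arrays `3` and `4`. -/
def outputEntry (A B : List ℕ → ℕ) (m u v w : ℕ) : ℕ × List ℕ → ℕ
  | (4, [k, a, b, c, d]) => arcEntry A B m u v w k a b c d
  -- In array `3` this says that every subgraph is spanning.
  | _ => 1

/-- The entries in `R` are correct. -/
def FillState (A B : List ℕ → ℕ) (val : ℕ × List ℕ → ℕ) (R : Set (ℕ × List ℕ)) (a : Mem) :
    Prop :=
  a.arr 0 = A ∧ a.arr 1 = B ∧ ∀ p ∈ R, a.arr p.1 p.2 = val p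

theorem FillState.put {A B : List ℕ → ℕ} {val : ℕ × List ℕ → ℕ} {R : Set (ℕ × List ℕ)} {a : Mem}
    (h : FillState A B val R a) {b : ℕ} (h0 : b ≠ 0) (h1 : b ≠ 1) {i : List ℕ} {x : ℕ}
    (hx : x = val (b, i)) : FillState A B val (R ∪ {(b, i)}) (a.put b i x) := by
  refine ⟨?_, ?_, ?_⟩
  · simp [Mem.put, Function.update_of_ne h0.symm, h.1]
  · simp [Mem.put, Function.update_of_ne h1.symm, h.2.1]
  · rintro ⟨c, j⟩ hp
    by_cases hcj : c = b ∧ j = i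
    · obtain ⟨rfl, rfl⟩ := hcj
      simp [Mem.put, hx]
    · have hR : (c, j) ∈ R := by
        rcases hp with hp | hp
        · exact hp
        · exact (hcj (by simpa using hp)).elim
      rw [← h.2.2 _ hR]
      by_cases hc : c = b
      · subst hc
        simp only [Mem.put, Function.update_self]
        rw [Function.update_of_ne fun hj => hcj ⟨rfl, hj⟩]
      · simp only [Mem.put]
        rw [Function.update_of_ne hc]

theorem progress_write {A B : List ℕ → ℕ} {val : ℕ × List ℕ → ℕ} {M : Finset (Fin 20)}
    {ρ : Fin 20 → ℕ} {b : ℕ} (h0 : b ≠ 0) (h1 : b ≠ 1) {idx : List (Fin 20)} {e : Arith}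
    (hidx : ∀ x ∈ idx, x ∉ M)
    (h : ∀ a : Mem, a.Agrees ρ M → a.arr 0 = A → a.arr 1 = B → e.eval a = val (b, idx.map ρ)) :
    Progress (FillState A B val) M ρ (write b idx e) {(b, idx.map ρ)}
      (e.cost + idx.length + 1) := by
  intro R
  refine (Hoare.write b idx e _).consequence ?_ (fun _ h => h) le_rfl
  rintro a ⟨ha, hs⟩
  have hmap : idx.map a.env = idx.map ρ := List.map_congr_left fun x hx => ha x (hidx x hx)
  rw [hmap]
  exact ⟨ha, hs.put h0 h1 (h a ha hs.1 hs.2.1)⟩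

def fillCost (N : ℕ) : ℕ :=
  N * (N * (N * (2 + (N + 1) * 5 + (1 + 3 + 1 +
    (N * (N * (arcArith.cost + 5 + 1 + 5) + 3 + 5) + 3)) + 5) + 3 + 5) + 3 + 5) + 3

/-- The entries that make up the output. -/
def outputIndices (n m : ℕ) : Set (ℕ × List ℕ) :=
  {p | ∃ k < m, ∃ a < n, ∃ b < m, p = (3, [k, a, b]) ∨
    ∃ c < n, ∃ d < m, p = (4, [k, a, b, c, d])}

theorem progress_fill {A B : List ℕ → ℕ} {ρ : Fin 20 → ℕ} {n m N : ℕ} (h0 : ρ 0 = n)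
    (h1 : ρ 1 = m) (h2 : ρ 2 = m / 2) (h3 : ρ 3 = m % 4) (h14 : ρ 14 = 3) (hn : n ≤ N)
    (hm : m ≤ N) :
    Progress (FillState A B (outputEntry A B m (ρ 4) (ρ 5) (ρ 6))) {7, 8, 9, 10, 11, 12} ρ fill
      (outputIndices n m) (fillCost N) := by
  subst h0 h1
  set val := outputEntry A B (ρ 1) (ρ 4) (ρ 5) (ρ 6) with hval
  have hΦ : ∀ (x : Fin 20) R a v, FillState A B val R a → FillState A B val R (a.set x v) :=
    fun _ _ _ _ h => h
  refine Progress.forLoop (C := fun k => {p | ∃ a < ρ 0, ∃ b < ρ 1, p = (3, [k, a, b]) ∨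
    ∃ c < ρ 0, ∃ d < ρ 1, p = (4, [k, a, b, c, d])}) (by decide) (by decide) (hΦ 7) hm
    fun k hk => ?_
  refine Progress.forLoop (C := fun a => {p | ∃ b < ρ 1, p = (3, [k, a, b]) ∨
    ∃ c < ρ 0, ∃ d < ρ 1, p = (4, [k, a, b, c, d])}) (by decide) (by decide) (hΦ 8) hn
    fun a ha => ?_
  refine Progress.forLoop (C := fun b => {p | p = (3, [k, a, b]) ∨
    ∃ c < ρ 0, ∃ d < ρ 1, p = (4, [k, a, b, c, d])}) (by decide) (by decide) (hΦ 9) hm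
    fun b hb => ?_
  refine Progress.bind (v := b % 4) (fun R => Hoare.modFour (by decide) (by decide) h14
    (hΦ 10 R) (hb.le.trans hm)) ?_
  refine Progress.seq (C := {(3, [k, a, b])}) (D := {p | ∃ c < ρ 0, ∃ d < ρ 1,
    p = (4, [k, a, b, c, d])}) ?_ ?_
  · exact progress_write (by decide) (by decide) (by decide) fun _ _ _ _ => rfl
  refine Progress.forLoop (C := fun c => {p | ∃ d < ρ 1, p = (4, [k, a, b, c, d])}) (by decide)
    (by decide) (hΦ 11) hn fun c hc => ?_
  -- The innermost body has no scratch registers: the loop rule is applied with `M = ∅`.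
  rw [← insert_empty_eq (β := Finset (Fin 20)) 12]
  refine Progress.forLoop (C := fun d => {(4, [k, a, b, c, d])}) (by decide)
    (by decide) (hΦ 12) hm fun d hd => ?_
  refine progress_write (by decide) (by decide) (by decide) fun s hs hA hB => ?_
  have hr : ∀ x, s.env x = _ := fun x => hs x (Finset.notMem_empty x)
  simp only [arcArith, Arith.eval, eval_addModArith, eval_arcShiftArith, hA, hB, List.map_cons,
    List.map_nil, hr, Function.update_apply, Fin.reduceEq, if_true, if_false, hval, outputEntry,
    arcEntry, h2, h3]

/-! ### The whole algorithm -/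

def algorithm : Prog :=
  .seq (assign 13 (.lit 1)) (.seq (assign 14 (.lit 3)) (.seq halve (.seq (modFour 3 1)
    (.seq search fill))))

def algorithmCost (N : ℕ) : ℕ :=
  2 + (2 + (2 + (2 + (N + 1) * 9) + (2 + (N + 1) * 5 + (searchCost N + fillCost N))))

theorem Hoare.algorithm {n m N : ℕ} {A : ℕ → List ℕ → ℕ} (hn : n ≤ N) (hm : m ≤ N)
    (hA : ∃ u < n, ∃ v < n, ∃ w < n, IsShortCycleMatrix (A 0) u v w) :
    Hoare (fun a => a.env 0 = n ∧ a.env 1 = m ∧ a.arr = A) algorithm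
      (fun a => ∃ u v w, IsShortCycleMatrix (A 0) u v w ∧
        ∀ p ∈ outputIndices n m, a.arr p.1 p.2 = outputEntry (A 0) (A 1) m u v w p)
      (algorithmCost N) := by
  refine .seq ((Hoare.assign 13 _ (fun a => a.env 0 = n ∧ a.env 1 = m ∧ a.env 13 = 1 ∧
    a.arr = A)).consequence ?_ (fun _ h => h) le_rfl) (.seq ((Hoare.assign 14 _ _).consequence ?_
    (fun _ h => h) le_rfl) (.seq (Hoare.halve (n := n) (A := A) hm) (.seq
      (Q := fun a => a.env 0 = n ∧ a.env 1 = m ∧ a.env 2 = m / 2 ∧ a.env 3 = m % 4 ∧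
        a.env 13 = 1 ∧ a.env 14 = 3 ∧ a.arr = A) ?_
    (.seq (Q := fun a => a.env 0 = n ∧ a.env 1 = m ∧ a.env 2 = m / 2 ∧ a.env 3 = m % 4 ∧
        a.env 14 = 3 ∧ a.arr = A ∧ IsShortCycleMatrix (A 0) (a.env 4) (a.env 5) (a.env 6))
      ?_ ?_))))
  · rintro a ⟨h0, h1, hA⟩
    simp [Mem.set, Arith.eval, *]
  · rintro a ⟨h0, h1, h13, hA⟩
    simp [Mem.set, Arith.eval, *]
  · rintro s ⟨h0, h1, h2, h13, h14, hA⟩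
    obtain ⟨s', t, he, ht, ha, hA'⟩ := Hoare.modFour (Φ := fun a => a.arr = A) (M := ∅)
      (ρ := s.mem.env) (x := 3) (y := 1) (N := N) (by decide) (by decide) h14
      (fun _ _ h => h) (h1.trans_le hm) s ⟨fun _ _ => rfl, hA⟩
    refine ⟨s', t, he, ht, ?_⟩
    have hr : ∀ x, s'.mem.env x = _ := fun x => ha x (Finset.notMem_empty x)
    simp [*]
  · rintro s ⟨h0, h1, h2, h3, h13, h14, hs⟩
    obtain ⟨s', t, he, ht, ha, hA', hf⟩ := progress_search (A := A) (ρ := s.mem.env) (N := N) h13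
      -- With nothing examined yet, the second alternative of `SearchState` is vacuous, whatever
      -- registers `4`, `5`, `6` contain.
      (h0.trans_le hn) ∅ s ⟨fun _ _ => rfl, hs, .inr fun p hp => hp.elim⟩
    refine ⟨s', t, he, ht, (ha 0 (by decide)).trans h0, (ha 1 (by decide)).trans h1,
      (ha 2 (by decide)).trans h2, (ha 3 (by decide)).trans h3, (ha 14 (by decide)).trans h14,
      hA', hf.resolve_right fun hno => ?_⟩
    obtain ⟨u, hu, v, hv, w, hw, hc⟩ := hA
    rw [h0] at hno
    exact hno (u, v, w) (.inr ⟨u, hu, v, hv, w, hw, rfl⟩) hc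
  · rintro s ⟨h0, h1, h2, h3, h14, hs, hc⟩
    obtain ⟨s', t, he, ht, -, -, -, hf⟩ := progress_fill (A := A 0) (B := A 1) h0 h1 h2 h3 h14 hn
      hm ∅ s ⟨fun _ _ => rfl, by rw [hs], by rw [hs], fun p hp => hp.elim⟩
    exact ⟨s', t, he, ht, _, _, _, hc, fun p hp => hf p (.inr hp)⟩

/-- The function is given by a polynomial. -/
def IsPolynomial (f : ℕ → ℕ) : Prop :=
  ∃ p : Polynomial ℕ, ∀ N, p.eval N = f N

theorem IsPolynomial.const (c : ℕ) : IsPolynomial fun _ => c :=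
  ⟨.C c, fun _ => Polynomial.eval_C⟩

theorem IsPolynomial.id : IsPolynomial fun N => N :=
  ⟨.X, fun _ => Polynomial.eval_X⟩

theorem IsPolynomial.add {f g : ℕ → ℕ} (hf : IsPolynomial f) (hg : IsPolynomial g) :
    IsPolynomial fun N => f N + g N := by
  obtain ⟨p, hp⟩ := hf
  obtain ⟨q, hq⟩ := hg
  exact ⟨p + q, fun N => by rw [Polynomial.eval_add, hp, hq]⟩

theorem IsPolynomial.mul {f g : ℕ → ℕ} (hf : IsPolynomial f) (hg : IsPolynomial g) :
    IsPolynomial fun N => f N * g N := by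
  obtain ⟨p, hp⟩ := hf
  obtain ⟨q, hq⟩ := hg
  exact ⟨p * q, fun N => by rw [Polynomial.eval_mul, hp, hq]⟩

theorem isPolynomial_algorithmCost : IsPolynomial algorithmCost := by
  unfold algorithmCost searchCost fillCost
  generalize shortCycleTest.cost = c
  generalize arcArith.cost = c'
  repeat' first
    | exact .const _
    | exact .id
    | apply IsPolynomial.add
    | apply IsPolynomial.mul

/-! ### Translation between digraphs and their adjacency matrices -/

section Input

variable {n m : ℕ} (G : Digraph (Fin n)) (H : Digraph (Fin m)) (S : Finset (Fin n × Fin m))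

theorem inputStore_left (u v : ℕ) : (inputStore G H S).arr 0 [u, v] = 1 ↔
    ∃ (hu : u < n) (hv : v < n), G.Adj ⟨u, hu⟩ ⟨v, hv⟩ := by
  simp only [inputStore]
  split_ifs with h
  · refine iff_of_true rfl ?_
    rcases h with ⟨-, u', v', h', hG⟩ | ⟨h', -⟩ | ⟨h', -⟩
    · simp only [List.cons.injEq, and_true] at h'
      obtain ⟨rfl, rfl⟩ := h'
      exact ⟨u'.2, v'.2, hG⟩
    all_goals exact absurd h' (by decide)
  · exact iff_of_false id fun ⟨_, _, hG⟩ => h (.inl ⟨rfl, _, _, rfl, hG⟩)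

theorem inputStore_right (x y : Fin m) :
    (inputStore G H S).arr 1 [x.val, y.val] = 1 ↔ H.Adj x y := by
  simp [inputStore, Fin.val_inj]

theorem isShortCycleMatrix_iff (u v w : Fin n) :
    IsShortCycleMatrix ((inputStore G H S).arr 0) u v w ↔ IsShortCycle G u v w := by
  simp only [IsShortCycleMatrix, IsShortCycle, inputStore_left, ne_eq, Fin.is_lt, exists_true_left,
    Fin.eta, Fin.val_inj]

/-- No range for the recorded numbers has to be kept during the search: a matrix entry `1` already
forces its indices below `n`. -/
theorem IsShortCycleMatrix.exists_fin {u v w : ℕ}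
    (h : IsShortCycleMatrix ((inputStore G H S).arr 0) u v w) :
    ∃ u' v' w' : Fin n, u' = u ∧ v' = v ∧ w' = w ∧ IsShortCycle G u' v' w' := by
  obtain ⟨hu, hv, -⟩ := (inputStore_left G H S _ _).1 h.1
  have hw : w < n := by
    rcases h.2 with ⟨rfl, -⟩ | ⟨-, h, -⟩
    · exact hu
    · exact ((inputStore_left G H S _ _).1 h).2.1
  exact ⟨⟨u, hu⟩, ⟨v, hv⟩, ⟨w, hw⟩, rfl, rfl, rfl, (isShortCycleMatrix_iff G H S _ _ _).1 h⟩

theorem arcEntry_eq_one_iff (u v w : Fin n) (k : Fin m) (p q : Fin n × Fin m) :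
    arcEntry ((inputStore G H S).arr 0) ((inputStore G H S).arr 1) m u v w k p.1 p.2 q.1 q.2 = 1 ↔
      (packing G H (Equiv.refl _) u v w k).Adj p q := by
  have h := inputStore_left G H S p.1 q.1
  have h' := inputStore_right G H S p.2 q.2
  simp only [Fin.is_lt, exists_true_left, Fin.eta] at h
  simp only [arcEntry, packing, arcShift_map Fin.val_injective, h, Fin.val_inj, Equiv.refl_apply]
  split_ifs <;> simp_all

end Input

end StrongPacking

theorem corollary4p8 :
    -- existence of `|V(H)|` pairwise arc-disjoint `S`-strong subgraphs of `G ∘ H`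
    (∀ {V : Type u} {W : Type v} [Fintype V] [Fintype W] (G : Digraph V) (H : Digraph W),
      StrongPacking.Admissible G H →
      ∀ S : Finset (V × W), 2 ≤ S.card → S.card ≤ Fintype.card (V × W) →
        ∃ F : Fin (Fintype.card W) → StrongPacking.Subdigraph (StrongPacking.lexProduct G H),
          StrongPacking.IsSStrongPacking S F) ∧
    -- a single program finds such subgraphs in time polynomial in the order of `G ∘ H`
    (∃ (P : StrongPacking.Prog) (p : Polynomial ℕ),
      ∀ (n m : ℕ) (G : Digraph (Fin n)) (H : Digraph (Fin m)),
        StrongPacking.Admissible G H →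
        ∀ S : Finset (Fin n × Fin m), 2 ≤ S.card → S.card ≤ n * m →
          ∃ (s : StrongPacking.Store) (t : ℕ),
            StrongPacking.Exec P (StrongPacking.inputStore G H S) s t ∧
            t ≤ p.eval (n * m) ∧
            ∃ F : Fin m → StrongPacking.Subdigraph (StrongPacking.lexProduct G H),
              StrongPacking.Outputs s F ∧ StrongPacking.IsSStrongPacking S F) := by
  classical
  refine ⟨fun G H hA S _ _ => ?_, ?_⟩
  · obtain ⟨u, v, w, hc⟩ := hA.exists_isShortCycle
    exact ⟨_, StrongPacking.packing_isSStrongPacking (Fintype.equivFin _) hA hc S⟩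
  obtain ⟨p, hp⟩ := StrongPacking.isPolynomial_algorithmCost
  refine ⟨StrongPacking.algorithm, p, fun n m G H hA S hS hS' => ?_⟩
  -- As both factors are positive, `n` and `m` are at most `n * m`, the argument of the cost
  -- polynomial.
  have hpos : 0 < n * m := by omega
  obtain ⟨s, t, he, ht, u, v, w, hc, hs⟩ := StrongPacking.Hoare.algorithm (n := n) (m := m)
    (A := (StrongPacking.inputStore G H S).arr)
    (Nat.le_mul_of_pos_right n (Nat.pos_of_mul_pos_left hpos))
    (Nat.le_mul_of_pos_left m (Nat.pos_of_mul_pos_right hpos)) (by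
      obtain ⟨u, v, w, hc⟩ := hA.exists_isShortCycle
      exact ⟨u, u.2, v, v.2, w, w.2, (StrongPacking.isShortCycleMatrix_iff G H S u v w).2 hc⟩)
    (StrongPacking.inputStore G H S) ⟨rfl, rfl, rfl⟩
  obtain ⟨u, v, w, rfl, rfl, rfl, hc'⟩ := hc.exists_fin
  refine ⟨s, t, he, (hp _).symm ▸ ht, StrongPacking.packing G H (Equiv.refl _) u v w,
    fun k => ⟨fun p => ?_, fun p q => ?_⟩,
    StrongPacking.packing_isSStrongPacking (Equiv.refl _) hA hc' S⟩
  · exact iff_of_true (hs (3, [k, p.1, p.2]) ⟨k, k.2, p.1, p.1.2, p.2, p.2.2, .inl rfl⟩) trivial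
  · rw [← StrongPacking.arcEntry_eq_one_iff G H S]
    exact (hs (4, [k, p.1, p.2, q.1, q.2]) ⟨k, k.2, p.1, p.1.2, p.2, p.2.2,
      .inr ⟨q.1, q.1.2, q.2, q.2.2, rfl⟩⟩).congr_left
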